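/- Let $f:\mathbb R\to\mathbb R$ be piecewise smooth: $\mathbb R$ is a disjoint union of finitely many intervals, on each of which $f$ is continuously differentiable and either strictly monotonic or constant; and $H(\lfloor f(Z)\rfloor)<\infty$ for $Z\sim\mathcal N(0,1)$, where $H$ is Shannon entropy. Assume that the information dimension $d(f(Z))=\lim_{M\to\infty}H(\lfloor Mf(Z)\rfloor/M)/\log M$ exists and $d(f(Z))\neq0$. Let $\delta>1$, and let $P_\lambda$ denote a probability law with support in a compact interval $[a,b]$, $a>0$, and $\mathbb E[\lambda]=\delta$. *Noiseless threshold.* For $v\in(0,1]$ let $\mathsf{mmse}_z(v)=\mathbb E\big[(Z-\mathbb E[Z\mid \sqrt{v^{-1}-1}\,Z+N,\,f(Z)])^2\big]$ with $Z,N$ independent standard Gaussians, $\phi(v)=\big(\tfrac1{\mathsf{mmse}_z(v)}-\tfrac1v\big)^{-1}\in[0,\infty]$, $\phi(0)=\lim_{v\to0+}\phi(v)$, and $\mathsf{MSE}_\lambda(V)=\mathbb E\big[\tfrac{V}{V+\lambda}\big]$ (with $\mathsf{MSE}_\lambda(\infty)=1$). For $\delta'>1$ put $P_{\delta'}(v)=\mathsf{MSE}_\lambda(\phi(v))-\big[1-\delta'\big(1-\tfrac{\mathsf{mmse}_z(v)}{v}\big)\big]$,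 let $V_r^\star$ be the infimum of the $v\in(0,1]$ such that $P_{\delta'}(u)>0$ for all $u\in[v,1]$ ($V_r^\star=1$ if there is none), and let $\mathsf{MSE}^\star_{\lambda}=\mathsf{MSE}_\lambda(\phi(V_r^\star))$. Define $\delta^{\mathsf p}_\lambda=\inf\{\delta'>1:\mathsf{MSE}^\star_\lambda=0\}$ (with $P_\lambda$ fixed, and $\inf\emptyset=+\infty$). *Noisy state evolution.* For the model $\boldsymbol y=f(\boldsymbol{Ax}+\boldsymbol w)$ with noise variance $\sigma_w^2>0$, let $\mathsf{mmse}_z(v,\sigma_w^2)=\mathbb E\big[(Z-\mathbb E[Z\mid f(Z+\sigma_wW),\,(1-v)Z+\sqrt{v(1-v)}N])^2\big]$ with $Z,W,N$ independent standard Gaussians, $\phi(v,\sigma_w^2)=\big(\tfrac1{\mathsf{mmse}_z(v,\sigma_w^2)}-\tfrac1v\big)^{-1}\in[0,\infty]$, $\Phi(V)=\Big(\big(\tfrac1\delta\mathbb E\big[\tfrac{V\lambda}{V+\lambda}\big]\big)^{-1}-\tfrac1V\Big)^{-1}$, and define $V_r^{-1}=1$ (the superscript being an index), $V_l^t=\phi(V_r^{t-1},\sigma_w^2)$,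 $V_r^t=\Phi(V_l^t)$ for $t\ge0$. *Claim.* There is a constant $0<C(\delta,f)<\infty$ depending only on $\delta$ and $f$ such that, for every such $P_\lambda$ with $\delta>\delta^{\mathsf p}_\lambda$: the limit $\mathsf{MSE}^\star_\lambda(\sigma_w^2)=\lim_{t\to\infty}\mathsf{MSE}_\lambda(V_l^t)$ exists for every $\sigma_w^2>0$, and $$\mathsf{MSE}^\star_\lambda(\sigma_w^2)=C(\delta,f)\,\mathbb E[\lambda^{-1}]\,\sigma_w^2\,(1+o(1))\qquad(\sigma_w^2\to0).$$ Hence recovery is stable: $\sup_{\sigma_w>0}\mathsf{MSE}^\star_\lambda(\sigma_w^2)/\sigma_w^2<\infty$. -/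

import Mathlib

open MeasureTheory ProbabilityTheory Filter Topology Asymptotics
open scoped ENNReal NNReal

namespace GLMEP

noncomputable section

/-! ### Information dimension -/

/-- Shannon entropy (in nats) of a probability measure on the integers, with value in `[0, ∞]`. -/
def entropy (ν : Measure ℤ) : ℝ≥0∞ :=
  ∑' k : ℤ, ENNReal.ofReal (Real.negMulLog (ν.real {k}))

/-- `H(⟨X⟩_M)` for `X ∼ ν`, where `⟨X⟩_M = ⌊M X⌋ / M`. The entropy is computed from the law of the
integer `⌊M X⌋`, which is `⟨X⟩_M` up to the injective relabelling `k ↦ k / M`. -/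
def quantizedEntropy (ν : Measure ℝ) (M : ℕ) : ℝ≥0∞ :=
  entropy (ν.map fun x => ⌊(M : ℝ) * x⌋)

/-- The information dimension of a random variable with law `ν` exists and equals `d`:
`H(⟨X⟩_M) / log M → d` as `M → ∞`. -/
def HasInformationDimension (ν : Measure ℝ) (d : ℝ≥0) : Prop :=
  Tendsto (fun M : ℕ => quantizedEntropy ν M / ENNReal.ofReal (Real.log M)) atTop (𝓝 (d : ℝ≥0∞))

/-- The standard Gaussian law. -/
abbrev stdGaussian : Measure ℝ := gaussianReal 0 1

/-- The law of `f(Z)`, where `Z ∼ N(0,1)`. -/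
def outputLaw (f : ℝ → ℝ) : Measure ℝ := stdGaussian.map f

/-! ### Assumption on the nonlinearity -/

/-- `f` is piecewise smooth: the real line is the disjoint union of finitely many intervals, on each
of which `f` is continuously differentiable and either strictly monotonic or constant; moreover
`H(⌊f(Z)⌋) < ∞` for `Z ∼ N(0,1)`. -/
def PiecewiseSmooth (f : ℝ → ℝ) : Prop :=
  (∃ (K : ℕ) (I : Fin K → Set ℝ),
    (∀ k, (I k).OrdConnected) ∧ Pairwise (fun j k => Disjoint (I j) (I k)) ∧
    (⋃ k, I k) = Set.univ ∧
    ∀ k, ContDiffOn ℝ 1 f (I k) ∧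
      (StrictMonoOn f (I k) ∨ StrictAntiOn f (I k) ∨ ∃ c, ∀ x ∈ I k, f x = c)) ∧
  quantizedEntropy (outputLaw f) 1 ≠ ∞

/-- Assumption on the limiting eigenvalue law `P` of `AᵀA` at sampling ratio `δ`: `P` is a probability
measure supported in a compact interval `[a, b]` with `a > 0`, and `E[λ] = δ > 1`. -/
structure IsSpectralLaw (P : Measure ℝ) (δ : ℝ) : Prop where
  isProb : IsProbabilityMeasure P
  support : ∃ a b : ℝ, 0 < a ∧ ∀ᵐ x ∂P, x ∈ Set.Icc a b
  one_lt : 1 < δ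
  mean : ∫ x, x ∂P = δ

/-! ### Minimum mean square errors -/

/-- `E[(Z - E[Z | T])²]`. -/
def mmseGiven {Ω 𝒯 : Type*} [MeasurableSpace Ω] [MeasurableSpace 𝒯]
    (μ : Measure Ω) (Z : Ω → ℝ) (T : Ω → 𝒯) : ℝ :=
  ∫ ω, (Z ω - (μ[Z | MeasurableSpace.comap T inferInstance]) ω) ^ 2 ∂μ

/-- The noiseless `mmse_z(v) = mmse(Z, v⁻¹ - 1 | f(Z))`, that is
`E[(Z - E[Z | √snr Z + N, f(Z)])²]` with `snr = v⁻¹ - 1`, for independent standard Gaussian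
`Z = ω.1` and `N = ω.2`; here `0 < v ≤ 1`. -/
def mmseZ (f : ℝ → ℝ) (v : ℝ) : ℝ :=
  mmseGiven (stdGaussian.prod stdGaussian) (fun ω : ℝ × ℝ => ω.1)
    (fun ω : ℝ × ℝ => (√(v⁻¹ - 1) * ω.1 + ω.2, f ω.1))

/-- The noisy `mmse_z(v, σ²) = E[(Z - E[Z | Y_σ, Z_r])²]`, where `Y_σ = f(Z + σ W)` and
`Z_r = (1 - v) Z + √(v (1 - v)) N`, for independent standard Gaussian
`Z = ω.1`, `W = ω.2.1`, `N = ω.2.2`. The argument `s` is the noise variance `σ²`. -/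
def mmseZNoisy (f : ℝ → ℝ) (s v : ℝ) : ℝ :=
  mmseGiven (stdGaussian.prod (stdGaussian.prod stdGaussian)) (fun ω : ℝ × ℝ × ℝ => ω.1)
    (fun ω : ℝ × ℝ × ℝ => (f (ω.1 + √s * ω.2.1), (1 - v) * ω.1 + √(v * (1 - v)) * ω.2.2))

/-! ### State evolution

The quantities `V_l` may be infinite, so they take values in `[0, ∞]`. -/

/-- `(1 / m - 1 / v)⁻¹` for `0 ≤ m ≤ v`, `v > 0`; it is `0` for `m = 0` and `∞` for `m = v`. -/
def extrinsic (m v : ℝ) : ℝ≥0∞ := ((ENNReal.ofReal m)⁻¹ - (ENNReal.ofReal v)⁻¹)⁻¹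

/-- The noiseless map `φ(v)`, `0 < v ≤ 1`. -/
def phi (f : ℝ → ℝ) (v : ℝ) : ℝ≥0∞ := extrinsic (mmseZ f v) v

/-- The noisy map `φ(v, σ²)`, `0 < v ≤ 1`, with `s = σ²`. -/
def phiNoisy (f : ℝ → ℝ) (s v : ℝ) : ℝ≥0∞ := extrinsic (mmseZNoisy f s v) v

/-- `Φ(V) = (1 / (δ⁻¹ E[V λ / (V + λ)]) - 1 / V)⁻¹`, where `V λ / (V + λ) = (1 / V + 1 / λ)⁻¹`.
In particular `Φ(0) = 0` and `Φ(∞) = E[λ] / δ`. -/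
def PhiMap (P : Measure ℝ) (δ : ℝ) (V : ℝ≥0∞) : ℝ :=
  (((ENNReal.ofReal δ)⁻¹ * ∫⁻ x, (V⁻¹ + (ENNReal.ofReal x)⁻¹)⁻¹ ∂P)⁻¹ - V⁻¹)⁻¹.toReal

/-- `MSE_λ(V) = E[V / (V + λ)]`, written as `E[(1 + λ / V)⁻¹]` so that the values at `V = 0` and
`V = ∞` are `0` and `1`. -/
def mse (P : Measure ℝ) (V : ℝ≥0∞) : ℝ :=
  ∫ x, ((1 + ENNReal.ofReal x / V)⁻¹).toReal ∂P

/-- `V_r^{t-1}` in the noisy setting: the sequence starts at `1`, and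
`V_r^t = Φ(φ(V_r^{t-1}, σ²))`. -/
def VrNoisy (f : ℝ → ℝ) (P : Measure ℝ) (δ s : ℝ) : ℕ → ℝ
  | 0 => 1
  | t + 1 => PhiMap P δ (phiNoisy f s (VrNoisy f P δ s t))

/-- `V_l^t = φ(V_r^{t-1}, σ²)`. -/
def VlNoisy (f : ℝ → ℝ) (P : Measure ℝ) (δ s : ℝ) (t : ℕ) : ℝ≥0∞ :=
  phiNoisy f s (VrNoisy f P δ s t)

/-- `MSE*_λ(σ²) = lim_{t → ∞} MSE_λ(V_l^t)`, with `s = σ²`. -/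
def mseStarNoisy (f : ℝ → ℝ) (P : Measure ℝ) (δ s : ℝ) : ℝ :=
  limUnder atTop fun t : ℕ => mse P (VlNoisy f P δ s t)

/-! ### The noiseless fixed point and the perfect recovery threshold -/

/-- `P(v) = E[φ(v) / (φ(v) + λ)] - [1 - δ (1 - mmse_z(v) / v)]`. -/
def Pfun (f : ℝ → ℝ) (P : Measure ℝ) (δ v : ℝ) : ℝ :=
  mse P (phi f v) - (1 - δ * (1 - mmseZ f v / v))

/-- The `v` such that `P > 0` on `[v, 1]`. (Whether `v = 0` is admitted does not change
the infimum.) -/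
def positiveSet (f : ℝ → ℝ) (P : Measure ℝ) (δ : ℝ) : Set ℝ :=
  {v | v ∈ Set.Ioc (0 : ℝ) 1 ∧ ∀ u ∈ Set.Icc v 1, 0 < Pfun f P δ u}

open Classical in
/-- `V_r^* = inf {v ∈ [0, 1] : P(u) > 0 for all u ∈ [v, 1]}`, and `V_r^* = 1` if there is no
such `v`. -/
def VrStar (f : ℝ → ℝ) (P : Measure ℝ) (δ : ℝ) : ℝ :=
  if (positiveSet f P δ).Nonempty then sInf (positiveSet f P δ) else 1

open Classical in
/-- `φ` on `[0, 1]`, with `φ(0) = lim_{v → 0+} φ(v)`. -/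
def phiExt (f : ℝ → ℝ) (v : ℝ) : ℝ≥0∞ :=
  if v = 0 then limUnder (𝓝[>] (0 : ℝ)) (phi f) else phi f v

/-- The noiseless final error `MSE*_λ = MSE_λ(φ(V_r^*))`. -/
def mseStar (f : ℝ → ℝ) (P : Measure ℝ) (δ : ℝ) : ℝ :=
  mse P (phiExt f (VrStar f P δ))

/-- `δ^p_λ = inf {δ > 1 : MSE*_λ = 0}`, which is `+∞` if there is no such `δ`. -/
def perfectThreshold (f : ℝ → ℝ) (P : Measure ℝ) : EReal :=
  sInf ((fun δ : ℝ => (δ : EReal)) '' {δ | 1 < δ ∧ mseStar f P δ = 0})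

end

end GLMEP

/-!
Written for the precisions `1 / V`, both maps of the noisy state evolution are monotone, so its
iterates decrease to a fixed point. Perfect recovery at some `δ' < δ` makes `Pfun f P δ'` positive
on `(0, 1]`; as the MMSE is semicontinuous in the noise variance, this rules out limit points of
the fixed points away from `0` as the noise vanishes.

What remains is the MMSE near `(v, s) = (0, 0)`. Conditionally on the side information, `Z` has
variance `v`, and its innovation is seen through the output exactly when `Z` lies on a piece where
`f` is injective, where the noise leaves the error `v * s / (v + s)`, while on a constant piece the
output carries no information. Hence `mmse_z(v, s) / v = 1 - p * v / (v + s) + o(1)`, with `p` the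
probability of the injective pieces, which is the information dimension of `f(Z)`. The fixed-point
equation then forces `s / V_r → p * δ - 1` and `V_r / V_l → 1 / (δ - 1)`, and since
`E[V / (V + λ)] ~ V * E[1 / λ]` the constant is `(δ - 1) / (p * δ - 1)`.
-/

namespace GLMEP

section MMSE

variable {Ω Ω' 𝒯 𝒯' : Type*} [MeasurableSpace Ω] [MeasurableSpace Ω'] [MeasurableSpace 𝒯]
  [MeasurableSpace 𝒯'] {μ : Measure Ω} {ν : Measure Ω'} {Z : Ω → ℝ} {T : Ω → 𝒯}

lemma mmseGiven_nonneg : 0 ≤ mmseGiven μ Z T := integral_nonneg fun _ => sq_nonneg _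

lemma mmseGiven_const_mul (a : ℝ) : mmseGiven μ (fun ω => a * Z ω) T = a ^ 2 * mmseGiven μ Z T := by
  rw [mmseGiven, mmseGiven, ← integral_const_mul]
  refine integral_congr_ae ?_
  filter_upwards [condExp_smul (μ := μ) a Z (MeasurableSpace.comap T inferInstance)] with ω hω
  rw [Pi.smul_apply, smul_eq_mul] at hω
  change (a * Z ω - (μ[a • Z | _]) ω) ^ 2 = _
  rw [hω]
  ring

lemma mmseGiven_le_integral_sq [IsFiniteMeasure μ] (hT : Measurable T) (hZ : MemLp Z 2 μ) :
    mmseGiven μ Z T ≤ ∫ ω, Z ω ^ 2 ∂μ := by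
  have h := integral_mono_ae integrable_condVar integrable_condExp
    (condVar_ae_le_condExp_sq hT.comap_le hZ)
  rwa [condVar, integral_condExp hT.comap_le, integral_condExp hT.comap_le] at h

lemma mmseGiven_add_comp [IsFiniteMeasure μ] (hT : Measurable T) (hZ : Integrable Z μ) {h : 𝒯 → ℝ}
    (hh : Measurable h) (hhT : Integrable (fun ω => h (T ω)) μ) :
    mmseGiven μ (fun ω => Z ω + h (T ω)) T = mmseGiven μ Z T := by
  have hobs : μ[fun ω => h (T ω) | MeasurableSpace.comap T inferInstance] = fun ω => h (T ω) :=
    condExp_of_stronglyMeasurable hT.comap_le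
      (hh.comp (comap_measurable T)).stronglyMeasurable hhT
  refine integral_congr_ae ?_
  filter_upwards [condExp_add hZ hhT (MeasurableSpace.comap T inferInstance)] with ω hω
  rw [Pi.add_apply, hobs] at hω
  change (Z ω + h (T ω) - (μ[Z + fun ω => h (T ω) | _]) ω) ^ 2 = _
  rw [hω]
  ring

lemma mmseGiven_le [IsFiniteMeasure μ] (hT : Measurable T) (hZ : MemLp Z 2 μ)
    {g : 𝒯 → ℝ} (hg : Measurable g) (hgT : MemLp (fun ω => g (T ω)) 2 μ) :
    mmseGiven μ Z T ≤ ∫ ω, (Z ω - g (T ω)) ^ 2 ∂μ := by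
  rw [← mmseGiven_add_comp hT (hZ.integrable one_le_two) (h := fun t => -g t) hg.neg
    (hgT.integrable one_le_two).neg]
  exact mmseGiven_le_integral_sq hT (hZ.sub hgT)

lemma exists_mmseGiven_eq (hZ : MemLp Z 2 μ) (T : Ω → 𝒯) :
    ∃ g : 𝒯 → ℝ, Measurable g ∧ MemLp (fun ω => g (T ω)) 2 μ ∧
      mmseGiven μ Z T = ∫ ω, (Z ω - g (T ω)) ^ 2 ∂μ := by
  obtain ⟨g, hg, hgT⟩ := (stronglyMeasurable_condExp (μ := μ) (f := Z)
    (m := MeasurableSpace.comap T inferInstance)).exists_eq_measurable_comp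
  refine ⟨g, hg.measurable, ?_, ?_⟩
  · change MemLp (g ∘ T) 2 μ
    rw [← hgT]
    exact MemLp.condExp one_le_two hZ
  · rw [mmseGiven, hgT]
    rfl

lemma mmseGiven_le_mmseGiven_comp [IsFiniteMeasure μ] (hT : Measurable T) (hZ : MemLp Z 2 μ)
    {φ : 𝒯 → 𝒯'} (hφ : Measurable φ) : mmseGiven μ Z T ≤ mmseGiven μ Z fun ω => φ (T ω) := by
  obtain ⟨g, hg, hgT, hm⟩ := exists_mmseGiven_eq hZ fun ω => φ (T ω)
  exact hm ▸ mmseGiven_le hT hZ (hg.comp hφ) hgT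

lemma memLp_comp_iff_of_measurePreserving {Θ : Ω' → Ω} (hΘ : MeasurePreserving Θ ν μ)
    {F : Ω → ℝ} (hF : Measurable F) {p : ℝ≥0∞} :
    MemLp (fun ω => F (Θ ω)) p ν ↔ MemLp F p μ := by
  rw [← hΘ.map_eq, memLp_map_measure_iff hF.aestronglyMeasurable hΘ.measurable.aemeasurable]
  rfl

lemma integral_comp_of_measurePreserving {Θ : Ω' → Ω} (hΘ : MeasurePreserving Θ ν μ)
    {F : Ω → ℝ} (hF : AEStronglyMeasurable F μ) : ∫ ω, F (Θ ω) ∂ν = ∫ ω, F ω ∂μ := by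
  rw [← hΘ.map_eq, integral_map hΘ.measurable.aemeasurable (by rwa [hΘ.map_eq])]

lemma mmseGiven_comp_measurePreserving [IsFiniteMeasure μ] [IsFiniteMeasure ν] {Θ : Ω' → Ω}
    (hΘ : MeasurePreserving Θ ν μ) (hT : Measurable T) (hZ : MemLp Z 2 μ) :
    mmseGiven ν (fun ω => Z (Θ ω)) (fun ω => T (Θ ω)) = mmseGiven μ Z T := by
  have hmse {g : 𝒯 → ℝ} (hgT : MemLp (fun ω => g (T ω)) 2 μ) :
      ∫ ω, (Z (Θ ω) - g (T (Θ ω))) ^ 2 ∂ν = ∫ ω, (Z ω - g (T ω)) ^ 2 ∂μ :=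
    integral_comp_of_measurePreserving hΘ (hZ.sub hgT).integrable_sq.aestronglyMeasurable
  have hZ' : MemLp (fun ω => Z (Θ ω)) 2 ν := hZ.comp_measurePreserving hΘ
  apply le_antisymm
  · obtain ⟨g, hg, hgT, hm⟩ := exists_mmseGiven_eq hZ T
    rw [hm, ← hmse hgT]
    exact mmseGiven_le (hT.comp hΘ.measurable) hZ' hg (hgT.comp_measurePreserving hΘ)
  · obtain ⟨g, hg, hgT, hm⟩ := exists_mmseGiven_eq hZ' (fun ω => T (Θ ω))
    have hgT' := (memLp_comp_iff_of_measurePreserving hΘ (hg.comp hT)).1 hgT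
    rw [hm, hmse hgT']
    exact mmseGiven_le hT hZ hg hgT'

lemma mmseGiven_prod_randomization [IsFiniteMeasure μ] [IsProbabilityMeasure ν]
    (hT : Measurable T) (hZ : MemLp Z 2 μ) :
    mmseGiven (μ.prod ν) (fun ω => Z ω.1) (fun ω => (T ω.1, ω.2)) = mmseGiven μ Z T := by
  have hZ' := hZ.comp_fst ν
  apply le_antisymm
  · rw [← mmseGiven_comp_measurePreserving (measurePreserving_fst (ν := ν)) hT hZ]
    exact mmseGiven_le_mmseGiven_comp (T := fun ω : Ω × Ω' => (T ω.1, ω.2)) (by fun_prop) hZ'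
      measurable_fst
  · obtain ⟨g, hg, hgT, hm⟩ := exists_mmseGiven_eq hZ' (fun ω => (T ω.1, ω.2))
    have hint : Integrable (fun ω : Ω × Ω' => (Z ω.1 - g (T ω.1, ω.2)) ^ 2) (μ.prod ν) :=
      (hZ'.sub hgT).integrable_sq
    rw [hm, integral_prod_symm _ hint]
    have hslice : ∀ᵐ y ∂ν, mmseGiven μ Z T ≤ ∫ x, (Z x - g (T x, y)) ^ 2 ∂μ := by
      filter_upwards [hgT.integrable_sq.prod_left_ae] with y hy
      have hgy : Measurable fun t => g (t, y) := hg.comp (by fun_prop)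
      exact mmseGiven_le hT hZ hgy
        ((memLp_two_iff_integrable_sq (hgy.comp hT).aestronglyMeasurable).2 hy)
    calc mmseGiven μ Z T = ∫ _, mmseGiven μ Z T ∂ν := by simp
      _ ≤ _ := integral_mono_ae (integrable_const _) hint.integral_prod_right hslice

lemma integral_sq_add_const_mul_snd [IsProbabilityMeasure μ] {ν : Measure ℝ}
    [IsProbabilityMeasure ν] {D : Ω → ℝ} (hD : MemLp D 2 μ) (hν : MemLp (fun y => y) 2 ν)
    (hmean : ∫ y, y ∂ν = 0) (b : ℝ) :
    ∫ ω, (D ω.1 + b * ω.2) ^ 2 ∂(μ.prod ν) = ∫ ω, D ω ^ 2 ∂μ + b ^ 2 * ∫ y, y ^ 2 ∂ν := by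
  have h1 := hD.comp_fst ν
  have h2 := hν.comp_snd μ
  have hexp (ω : Ω × ℝ) :
      (D ω.1 + b * ω.2) ^ 2 = D ω.1 ^ 2 + 2 * b * (D ω.1 * ω.2) + b ^ 2 * ω.2 ^ 2 := by ring
  have hcross : Integrable (fun ω : Ω × ℝ => 2 * b * (D ω.1 * ω.2)) (μ.prod ν) :=
    (h1.integrable_mul h2).const_mul _
  have hsum : Integrable (fun ω : Ω × ℝ => D ω.1 ^ 2 + 2 * b * (D ω.1 * ω.2)) (μ.prod ν) :=
    h1.integrable_sq.add hcross
  simp_rw [hexp]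
  rw [integral_add hsum (h2.integrable_sq.const_mul _),
    integral_add h1.integrable_sq hcross, integral_const_mul, integral_const_mul,
    integral_prod_mul D fun y => y, hmean, integral_fun_fst fun ω => D ω ^ 2,
    integral_fun_snd fun y : ℝ => y ^ 2]
  simp

lemma mmseGiven_add_indep_noise [IsProbabilityMeasure μ] {ν : Measure ℝ} [IsProbabilityMeasure ν]
    (hT : Measurable T) (hZ : MemLp Z 2 μ) (hν : MemLp (fun y => y) 2 ν) (hmean : ∫ y, y ∂ν = 0)
    (b : ℝ) :
    mmseGiven (μ.prod ν) (fun ω => Z ω.1 + b * ω.2) (fun ω => T ω.1) =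
      mmseGiven μ Z T + b ^ 2 * ∫ y, y ^ 2 ∂ν := by
  have hmse {g : 𝒯 → ℝ} (hgT : MemLp (fun ω => g (T ω)) 2 μ) :
      ∫ ω, (Z ω.1 + b * ω.2 - g (T ω.1)) ^ 2 ∂(μ.prod ν) =
        ∫ ω, (Z ω - g (T ω)) ^ 2 ∂μ + b ^ 2 * ∫ y, y ^ 2 ∂ν := by
    simp_rw [add_sub_right_comm]
    exact integral_sq_add_const_mul_snd (hZ.sub hgT) hν hmean b
  have hZ' : MemLp (fun ω : Ω × ℝ => Z ω.1 + b * ω.2) 2 (μ.prod ν) :=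
    (hZ.comp_fst ν).add ((hν.comp_snd μ).const_mul b)
  apply le_antisymm
  · obtain ⟨g, hg, hgT, hm⟩ := exists_mmseGiven_eq hZ T
    rw [hm, ← hmse hgT]
    exact mmseGiven_le (hT.comp measurable_fst) hZ' hg (hgT.comp_fst ν)
  · obtain ⟨g, hg, hgT, hm⟩ := exists_mmseGiven_eq hZ' (fun ω => T ω.1)
    have hgT' := (memLp_comp_iff_of_measurePreserving measurePreserving_fst (hg.comp hT)).1 hgT
    rw [hm, hmse hgT']
    gcongr
    exact mmseGiven_le hT hZ hg hgT'

-- On `B` the estimation error `Z - g(T)` and its reflection `-Z - g(T)` have the same law.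
lemma setIntegral_sq_le_mmseGiven (hZ : MemLp Z 2 μ) {B : Set Ω} (hB : MeasurableSet B)
    {σ : Ω → Ω} (hσ : MeasurePreserving σ μ μ) (hσB : σ ⁻¹' B = B) (hσT : ∀ ω ∈ B, T (σ ω) = T ω)
    (hσZ : ∀ ω ∈ B, Z (σ ω) = -Z ω) : ∫ ω in B, Z ω ^ 2 ∂μ ≤ mmseGiven μ Z T := by
  obtain ⟨g, -, hgT, hm⟩ := exists_mmseGiven_eq hZ T
  have hσμ : MeasurePreserving σ (μ.restrict B) (μ.restrict B) := by
    simpa only [hσB] using hσ.restrict_preimage hB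
  have hminus : Integrable (fun ω => (Z ω - g (T ω)) ^ 2) (μ.restrict B) :=
    (hZ.sub hgT).integrable_sq.restrict
  have hplus : Integrable (fun ω => (Z ω + g (T ω)) ^ 2) (μ.restrict B) :=
    (hZ.add hgT).integrable_sq.restrict
  have hreflect : ∫ ω in B, (Z ω + g (T ω)) ^ 2 ∂μ = ∫ ω in B, (Z ω - g (T ω)) ^ 2 ∂μ := by
    rw [← integral_comp_of_measurePreserving hσμ hminus.aestronglyMeasurable]
    refine setIntegral_congr_fun hB fun ω hω => ?_
    simp only [hσT ω hω, hσZ ω hω]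
    ring
  calc ∫ ω in B, Z ω ^ 2 ∂μ
      ≤ ∫ ω in B, ((Z ω - g (T ω)) ^ 2 / 2 + (Z ω + g (T ω)) ^ 2 / 2) ∂μ :=
        integral_mono hZ.integrable_sq.restrict ((hminus.div_const 2).add (hplus.div_const 2))
          fun ω => by nlinarith [sq_nonneg (g (T ω))]
    _ = ∫ ω in B, (Z ω - g (T ω)) ^ 2 ∂μ := by
        rw [integral_add (hminus.div_const 2) (hplus.div_const 2), integral_div, integral_div]
        linarith [hreflect]
    _ ≤ ∫ ω, (Z ω - g (T ω)) ^ 2 ∂μ :=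
        setIntegral_le_integral (hZ.sub hgT).integrable_sq (ae_of_all _ fun _ => sq_nonneg _)
    _ = mmseGiven μ Z T := hm.symm

end MMSE

section Semicontinuity

variable {Ω 𝒯 : Type*} [MeasurableSpace Ω] {μ : Measure Ω} [IsFiniteMeasure μ]
  [TopologicalSpace 𝒯] [TopologicalSpace.MetrizableSpace 𝒯] [MeasurableSpace 𝒯] [BorelSpace 𝒯]
  {Z : Ω → ℝ}

lemma add_sq_le_of_pos {t : ℝ} (ht : 0 < t) (a b : ℝ) :
    (a + b) ^ 2 ≤ (1 + t) * a ^ 2 + (1 + t⁻¹) * b ^ 2 := by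
  have hsq : (1 + t) * a ^ 2 + (1 + t⁻¹) * b ^ 2 - (a + b) ^ 2 = t * (a - t⁻¹ * b) ^ 2 := by
    field_simp
    ring
  exact sub_nonneg.1 (hsq ▸ by positivity)

lemma exists_boundedContinuous_integral_sq_sub_lt {T : Ω → 𝒯} (hT : Measurable T)
    (hZ : MemLp Z 2 μ) {c : ℝ} (hc : mmseGiven μ Z T < c) :
    ∃ G : BoundedContinuousFunction 𝒯 ℝ, ∫ ω, (Z ω - G (T ω)) ^ 2 ∂μ < c := by
  obtain ⟨g, hg, hgT, hm⟩ := exists_mmseGiven_eq hZ T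
  set m := mmseGiven μ Z T
  obtain ⟨t, htc, ht⟩ : ∃ t : ℝ, (1 + t) * m + (t ^ 2 + t) < c ∧ 0 < t := by
    have hcont : Continuous fun t : ℝ => (1 + t) * m + (t ^ 2 + t) := by fun_prop
    have hlt := hcont.continuousAt.eventually_lt (x₀ := (0 : ℝ)) continuousAt_const
      (show _ < c by simpa using hc)
    exact ((hlt.filter_mono nhdsWithin_le_nhds).and self_mem_nhdsWithin).exists (f := 𝓝[>] 0)
  have hgμ : MemLp g (ENNReal.ofReal 2) (μ.map T) := by
    rw [ENNReal.ofReal_ofNat]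
    exact (memLp_map_measure_iff hg.aestronglyMeasurable hT.aemeasurable).2 hgT
  obtain ⟨G, hG, hGm⟩ :=
    hgμ.exists_boundedContinuous_integral_rpow_sub_le two_pos (sq_pos_of_pos ht)
  rw [ENNReal.ofReal_ofNat] at hGm
  have hGT : MemLp (fun ω => G (T ω)) 2 μ :=
    (memLp_map_measure_iff hGm.aestronglyMeasurable hT.aemeasurable).1 hGm
  simp only [Real.norm_eq_abs, Real.rpow_two, sq_abs] at hG
  rw [integral_map (f := fun y => (g y - G y) ^ 2) hT.aemeasurable
    ((hg.sub G.continuous.measurable).pow_const 2).aestronglyMeasurable] at hG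
  have hig := (hZ.sub hgT).integrable_sq.const_mul (1 + t)
  have hiG := (hgT.sub hGT).integrable_sq.const_mul (1 + t⁻¹)
  refine ⟨G, lt_of_le_of_lt ?_ htc⟩
  calc ∫ ω, (Z ω - G (T ω)) ^ 2 ∂μ
      ≤ ∫ ω, ((1 + t) * (Z ω - g (T ω)) ^ 2 + (1 + t⁻¹) * (g (T ω) - G (T ω)) ^ 2) ∂μ :=
        integral_mono (hZ.sub hGT).integrable_sq (hig.add hiG) fun ω => by
          simpa using add_sq_le_of_pos ht (Z ω - g (T ω)) (g (T ω) - G (T ω))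
    _ = (1 + t) * m + (1 + t⁻¹) * ∫ ω, (g (T ω) - G (T ω)) ^ 2 ∂μ := by
        rw [hm, ← integral_const_mul, ← integral_const_mul]
        exact integral_add hig hiG
    _ ≤ (1 + t) * m + (1 + t⁻¹) * t ^ 2 := by gcongr
    _ = (1 + t) * m + (t ^ 2 + t) := by field_simp

lemma eventually_mmseGiven_lt {ι : Type*} {l : Filter ι} [l.IsCountablyGenerated] {T : ι → Ω → 𝒯}
    {T₀ : Ω → 𝒯} (hT : ∀ x, Measurable (T x)) (hT₀ : Measurable T₀) (hZ : MemLp Z 2 μ)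
    (hlim : ∀ᵐ ω ∂μ, Tendsto (fun x => T x ω) l (𝓝 (T₀ ω))) {c : ℝ} (hc : mmseGiven μ Z T₀ < c) :
    ∀ᶠ x in l, mmseGiven μ Z (T x) < c := by
  obtain ⟨G, hG⟩ := exists_boundedContinuous_integral_sq_sub_lt hT₀ hZ hc
  have hGm : Measurable G := G.continuous.measurable
  have hGT (x : ι) : MemLp (fun ω => G (T x ω)) 2 μ :=
    MemLp.of_bound (hGm.comp (hT x)).aestronglyMeasurable ‖G‖
      (ae_of_all _ fun ω => G.norm_coe_le_norm _)
  have hmse : Tendsto (fun x => ∫ ω, (Z ω - G (T x ω)) ^ 2 ∂μ) l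
      (𝓝 (∫ ω, (Z ω - G (T₀ ω)) ^ 2 ∂μ)) := by
    refine tendsto_integral_filter_of_dominated_convergence (fun ω => (|Z ω| + ‖G‖) ^ 2)
      (Eventually.of_forall fun x => (hZ.sub (hGT x)).integrable_sq.aestronglyMeasurable)
      (Eventually.of_forall fun x => ae_of_all _ fun ω => ?_)
      (hZ.norm.add (memLp_const ‖G‖)).integrable_sq ?_
    · rw [Real.norm_of_nonneg (sq_nonneg _), ← sq_abs]
      gcongr
      exact (abs_sub _ _).trans (by gcongr; exact G.norm_coe_le_norm _)
    · filter_upwards [hlim] with ω hω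
      exact (((G.continuous.tendsto _).comp hω).const_sub _).pow 2
  filter_upwards [hmse.eventually_lt_const hG] with x hx
  exact (mmseGiven_le (hT x) hZ hGm (hGT x)).trans_lt hx

end Semicontinuity

section Channel

variable {Ω Ω' 𝒯 : Type*} [MeasurableSpace Ω] [MeasurableSpace Ω'] [MeasurableSpace 𝒯]
  {μ : Measure Ω} {μ' : Measure Ω'} {Z : Ω → ℝ} {Y : Ω → 𝒯}

lemma measurePreserving_neg_stdGaussian :
    MeasurePreserving (fun x : ℝ => -x) stdGaussian stdGaussian :=
  ⟨by fun_prop, by rw [gaussianReal_map_neg, neg_zero]⟩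

lemma memLp_id_stdGaussian : MemLp (fun x : ℝ => x) 2 stdGaussian := memLp_id_gaussianReal 2

lemma integral_sq_stdGaussian : ∫ x, x ^ 2 ∂stdGaussian = 1 := by
  have h := variance_fun_id_gaussianReal (μ := 0) (v := 1)
  rw [variance_eq_integral (by fun_prop)] at h
  simpa using h

lemma measurePreserving_reflection {a b : ℝ} (hab : a ^ 2 + b ^ 2 = 1) :
    MeasurePreserving (fun x : ℝ × ℝ => (a * x.1 + b * x.2, b * x.1 - a * x.2))
      (stdGaussian.prod stdGaussian) (stdGaussian.prod stdGaussian) := by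
  have hz : ‖(⟨a, b⟩ : ℂ)‖ = 1 := by
    rw [← sq_eq_sq₀ (norm_nonneg _) zero_le_one, Complex.sq_norm, Complex.normSq_mk]
    linarith [hab]
  have hcos : Real.cos (Complex.arg ⟨a, b⟩) = a := by
    simpa only [hz, one_mul] using Complex.norm_mul_cos_arg ⟨a, b⟩
  have hsin : Real.sin (Complex.arg ⟨a, b⟩) = b := by
    simpa only [hz, one_mul] using Complex.norm_mul_sin_arg ⟨a, b⟩
  have hmean (L : StrongDual ℝ ℝ) : stdGaussian[L] = 0 := by
    have hL : (fun x => L x) = fun x => x * L 1 := by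
      ext x
      rw [← smul_eq_mul, ← L.map_smul, smul_eq_mul, mul_one]
    rw [hL, integral_mul_const, integral_id_gaussianReal, zero_mul]
  have hrot : MeasurePreserving (fun x : ℝ × ℝ => (a * x.1 + b * x.2, -b * x.1 + a * x.2))
      (stdGaussian.prod stdGaussian) (stdGaussian.prod stdGaussian) := by
    refine ⟨by fun_prop, ?_⟩
    convert! IsGaussian.map_rotation_eq_self_of_forall_strongDual_eq_zero hmean
      (Complex.arg ⟨a, b⟩) using 2
    ext x <;> simp [ContinuousLinearMap.rotation_apply, hcos, hsin]
  convert! ((MeasurePreserving.id stdGaussian).prod measurePreserving_neg_stdGaussian).comp hrot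
    using 1
  ext x <;> simp
  ring

lemma measurePreserving_reflect_noises (μ : Measure Ω) [SFinite μ] {a b : ℝ}
    (hab : a ^ 2 + b ^ 2 = 1) :
    MeasurePreserving
      (fun ω : (Ω × ℝ) × ℝ => ((ω.1.1, a * ω.1.2 + b * ω.2), b * ω.1.2 - a * ω.2))
      ((μ.prod stdGaussian).prod stdGaussian) ((μ.prod stdGaussian).prod stdGaussian) :=
  (measurePreserving_prodAssoc μ stdGaussian stdGaussian).symm.comp
    (((MeasurePreserving.id μ).prod (measurePreserving_reflection hab)).comp
      (measurePreserving_prodAssoc μ stdGaussian stdGaussian))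

-- The linear estimator `g + c (e Z + N - e g)`, with `g = E[Z | T]` and `c = e m / (1 + e² m)`.
lemma mmseGiven_prod_gaussian_le [IsProbabilityMeasure μ] {T : Ω → 𝒯} (hT : Measurable T)
    (hZm : Measurable Z) (hZ : MemLp Z 2 μ) (e : ℝ) :
    mmseGiven (μ.prod stdGaussian) (fun ω => Z ω.1) (fun ω => (T ω.1, e * Z ω.1 + ω.2)) ≤
      mmseGiven μ Z T / (1 + e ^ 2 * mmseGiven μ Z T) := by
  obtain ⟨g, hg, hgT, hm⟩ := exists_mmseGiven_eq hZ T
  have hm0 : 0 ≤ mmseGiven μ Z T := mmseGiven_nonneg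
  set m := mmseGiven μ Z T
  set c := e * m / (1 + e ^ 2 * m) with hc
  have hZ' := hZ.comp_fst stdGaussian
  have hgT' : MemLp (fun ω : Ω × ℝ => g (T ω.1)) 2 (μ.prod stdGaussian) := hgT.comp_fst _
  have hN := memLp_id_stdGaussian.comp_snd μ
  refine (mmseGiven_le (by fun_prop) hZ' (g := fun y => g y.1 + c * (y.2 - e * g y.1))
    (by fun_prop) (hgT'.add ((((hZ'.const_mul e).add hN).sub
      (hgT'.const_mul e)).const_mul c))).trans_eq ?_
  have herr (ω : Ω × ℝ) : Z ω.1 - (g (T ω.1) + c * (e * Z ω.1 + ω.2 - e * g (T ω.1))) =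
      (1 - c * e) * (Z ω.1 - g (T ω.1)) + -c * ω.2 := by ring
  simp_rw [herr]
  rw [integral_sq_add_const_mul_snd (D := fun ω => (1 - c * e) * (Z ω - g (T ω)))
    ((hZ.sub hgT).const_mul _) memLp_id_stdGaussian integral_id_gaussianReal,
    integral_sq_stdGaussian]
  simp_rw [mul_pow]
  rw [integral_const_mul, ← hm, hc]
  field_simp
  ring

/-- The minimum mean square error of `Z` given the side information `Y` and the output
`√γ Z + N` of an independent Gaussian channel of signal-to-noise ratio `γ`. -/
noncomputable def channelMMSE (μ : Measure Ω) (Z : Ω → ℝ) (Y : Ω → 𝒯) (γ : ℝ) : ℝ :=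
  mmseGiven (μ.prod stdGaussian) (fun ω => Z ω.1) (fun ω => (√γ * Z ω.1 + ω.2, Y ω.1))

lemma channelMMSE_comp_measurePreserving [IsProbabilityMeasure μ] [IsProbabilityMeasure μ']
    {Θ : Ω' → Ω} (hΘ : MeasurePreserving Θ μ' μ) (hY : Measurable Y) (hZm : Measurable Z)
    (hZ : MemLp Z 2 μ) (γ : ℝ) :
    channelMMSE μ' (fun ω => Z (Θ ω)) (fun ω => Y (Θ ω)) γ = channelMMSE μ Z Y γ :=
  mmseGiven_comp_measurePreserving (hΘ.prod (MeasurePreserving.id stdGaussian))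
    (T := fun ω : Ω × ℝ => (√γ * Z ω.1 + ω.2, Y ω.1)) (by fun_prop) (hZ.comp_fst _)

-- Rotating the two noises, the outputs at signal-to-noise ratios `γ` and `η` become one output at
-- `γ + η` and an independent noise.
lemma channelMMSE_add_le [IsProbabilityMeasure μ] (hY : Measurable Y) (hZm : Measurable Z)
    (hZ : MemLp Z 2 μ) {γ η : ℝ} (hγ : 0 ≤ γ) (hη : 0 < η) :
    channelMMSE μ Z Y (γ + η) ≤ channelMMSE μ Z Y γ / (1 + η * channelMMSE μ Z Y γ) := by
  have hr : 0 < √(γ + η) := by positivity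
  set k := √γ
  set e := √η
  set r := √(γ + η)
  have hk2 : k ^ 2 = γ := Real.sq_sqrt hγ
  have he2 : e ^ 2 = η := Real.sq_sqrt hη.le
  have hr2 : r ^ 2 = γ + η := Real.sq_sqrt (by positivity)
  have hZ₂ := (hZ.comp_fst stdGaussian).comp_fst stdGaussian
  have hΘ := measurePreserving_reflect_noises μ (a := k / r) (b := e / r)
    (by rw [div_pow, div_pow, ← add_div, hk2, he2, hr2, div_self (hr2 ▸ by positivity)])
  have hkr : k / r * r = k := div_mul_cancel₀ _ hr.ne'
  have her : e / r * r = e := div_mul_cancel₀ _ hr.ne'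
  calc channelMMSE μ Z Y (γ + η)
      = mmseGiven ((μ.prod stdGaussian).prod stdGaussian) (fun ω => Z ω.1.1)
          (fun ω => ((r * Z ω.1.1 + ω.1.2, Y ω.1.1), ω.2)) :=
        (mmseGiven_prod_randomization (T := fun ω : Ω × ℝ => (r * Z ω.1 + ω.2, Y ω.1))
          (by fun_prop) (hZ.comp_fst _)).symm
    _ ≤ mmseGiven ((μ.prod stdGaussian).prod stdGaussian) (fun ω => Z ω.1.1)
          (fun ω => ((k / r * (r * Z ω.1.1 + ω.1.2) + e / r * ω.2, Y ω.1.1),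
            e / r * (r * Z ω.1.1 + ω.1.2) - k / r * ω.2)) :=
        mmseGiven_le_mmseGiven_comp (by fun_prop) hZ₂ (φ := fun y : (ℝ × 𝒯) × ℝ =>
          ((k / r * y.1.1 + e / r * y.2, y.1.2), e / r * y.1.1 - k / r * y.2)) (by fun_prop)
    _ = mmseGiven ((μ.prod stdGaussian).prod stdGaussian) (fun ω => Z ω.1.1)
          (fun ω => ((k * Z ω.1.1 + ω.1.2, Y ω.1.1), e * Z ω.1.1 + ω.2)) := by
        rw [← mmseGiven_comp_measurePreserving hΘ (T := fun ω : (Ω × ℝ) × ℝ =>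
          ((k * Z ω.1.1 + ω.1.2, Y ω.1.1), e * Z ω.1.1 + ω.2)) (by fun_prop) hZ₂]
        simp only [mul_add, ← mul_assoc, hkr, her, add_assoc, add_sub_assoc]
    _ ≤ channelMMSE μ Z Y γ / (1 + η * channelMMSE μ Z Y γ) := he2 ▸
        mmseGiven_prod_gaussian_le (T := fun ω : Ω × ℝ => (k * Z ω.1 + ω.2, Y ω.1)) (by fun_prop)
          (by fun_prop) (hZ.comp_fst _) e

variable {f : ℝ → ℝ}

lemma sqrt_mul_one_sub {v : ℝ} (hv : 0 < v) : √(v * (1 - v)) = v * √(v⁻¹ - 1) := by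
  have h : v * (1 - v) = v ^ 2 * (v⁻¹ - 1) := by field_simp
  rw [h, Real.sqrt_mul (sq_nonneg v), Real.sqrt_sq hv.le]

lemma inv_sub_one_nonneg {v : ℝ} (hv : 0 < v) (hv1 : v ≤ 1) : 0 ≤ v⁻¹ - 1 :=
  sub_nonneg.2 (one_le_inv_iff₀.2 ⟨hv, hv1⟩)

lemma mmseZ_eq_channelMMSE (f : ℝ → ℝ) (v : ℝ) :
    mmseZ f v = channelMMSE stdGaussian (fun z => z) f (v⁻¹ - 1) := rfl

lemma mmseGiven_scaled_channel_eq [IsProbabilityMeasure μ] (hY : Measurable Y)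
    (hZm : Measurable Z) (hZ : MemLp Z 2 μ) {v : ℝ} (hv : 0 < v) (hv1 : v ≤ 1) :
    mmseGiven (μ.prod stdGaussian) (fun ω => Z ω.1)
        (fun ω => (Y ω.1, (1 - v) * Z ω.1 + √(v * (1 - v)) * ω.2)) =
      channelMMSE μ Z Y (v⁻¹ - 1) := by
  have hZ' := hZ.comp_fst stdGaussian
  have hscale (ω : Ω × ℝ) : (1 - v) * Z ω.1 + √(v * (1 - v)) * ω.2 =
      v * √(v⁻¹ - 1) * (√(v⁻¹ - 1) * Z ω.1 + ω.2) := by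
    have h1v : 1 - v = v * √(v⁻¹ - 1) ^ 2 := by
      rw [Real.sq_sqrt (inv_sub_one_nonneg hv hv1)]
      field_simp
    rw [sqrt_mul_one_sub hv]
    linear_combination Z ω.1 * h1v
  simp only [hscale]
  apply le_antisymm
  · rcases hv1.lt_or_eq with hlt | rfl
    · have hk : 0 < √(v⁻¹ - 1) := Real.sqrt_pos.2 (sub_pos.2 ((one_lt_inv₀ hv).2 hlt))
      refine (mmseGiven_le_mmseGiven_comp (by fun_prop) hZ'
        (φ := fun y : 𝒯 × ℝ => (y.2 / (v * √(v⁻¹ - 1)), y.1)) (by fun_prop)).trans_eq ?_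
      simp only [mul_div_cancel_left₀ _ (mul_pos hv hk).ne']
      rfl
    · calc _ ≤ mmseGiven (μ.prod stdGaussian) (fun ω => Z ω.1) (fun ω => Y ω.1) :=
            mmseGiven_le_mmseGiven_comp (by fun_prop) hZ' (φ := Prod.fst) measurable_fst
        _ = mmseGiven (μ.prod stdGaussian) (fun ω => Z ω.1) (fun ω => (Y ω.1, ω.2)) := by
            rw [mmseGiven_prod_randomization hY hZ]
            exact mmseGiven_comp_measurePreserving measurePreserving_fst hY hZ
        _ ≤ mmseGiven (μ.prod stdGaussian) (fun ω => Z ω.1) (fun ω => (ω.2, Y ω.1)) :=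
            mmseGiven_le_mmseGiven_comp (by fun_prop) hZ' (φ := Prod.swap) measurable_swap
        _ = _ := by simp [channelMMSE]
  · exact mmseGiven_le_mmseGiven_comp (by fun_prop) hZ'
      (φ := fun y : ℝ × 𝒯 => (y.2, v * √(v⁻¹ - 1) * y.1)) (by fun_prop)

lemma memLp_fst_stdGaussian_prod :
    MemLp (fun x : ℝ × ℝ => x.1) 2 (stdGaussian.prod stdGaussian) :=
  memLp_id_stdGaussian.comp_fst _

lemma mmseZNoisy_eq_channelMMSE (hf : Measurable f) (s : ℝ) {v : ℝ} (hv : 0 < v) (hv1 : v ≤ 1) :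
    mmseZNoisy f s v = channelMMSE (stdGaussian.prod stdGaussian) (fun x : ℝ × ℝ => x.1)
      (fun x => f (x.1 + √s * x.2)) (v⁻¹ - 1) := by
  rw [← mmseGiven_scaled_channel_eq (by fun_prop) (by fun_prop) memLp_fst_stdGaussian_prod hv hv1]
  exact (mmseGiven_comp_measurePreserving
    (measurePreserving_prodAssoc stdGaussian stdGaussian stdGaussian) (by fun_prop)
    (memLp_id_stdGaussian.comp_fst _)).symm

lemma mmseZNoisy_zero (hf : Measurable f) {v : ℝ} (hv : 0 < v) (hv1 : v ≤ 1) :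
    mmseZNoisy f 0 v = mmseZ f v := by
  rw [mmseZNoisy_eq_channelMMSE hf 0 hv hv1, mmseZ_eq_channelMMSE]
  simpa using channelMMSE_comp_measurePreserving
    (measurePreserving_fst (μ := stdGaussian) (ν := stdGaussian)) hf (Z := fun z => z)
    measurable_id memLp_id_stdGaussian (v⁻¹ - 1)

lemma mmseZNoisy_mul_le (hf : Measurable f) (s : ℝ) {v v' : ℝ} (hv' : 0 < v') (hlt : v' < v)
    (hv1 : v ≤ 1) :
    mmseZNoisy f s v' * (1 + (v'⁻¹ - v⁻¹) * mmseZNoisy f s v) ≤ mmseZNoisy f s v := by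
  have hv : 0 < v := hv'.trans hlt
  have hη : 0 < v'⁻¹ - v⁻¹ := sub_pos.2 (inv_strictAnti₀ hv' hlt)
  have hm : 0 ≤ mmseZNoisy f s v := mmseGiven_nonneg
  rw [← le_div_iff₀ (by positivity), mmseZNoisy_eq_channelMMSE hf s hv hv1,
    mmseZNoisy_eq_channelMMSE hf s hv' (hlt.le.trans hv1)]
  simpa using channelMMSE_add_le (by fun_prop) (by fun_prop) memLp_fst_stdGaussian_prod
    (inv_sub_one_nonneg hv hv1) hη

end Channel

section Innovation

variable {f : ℝ → ℝ}

/-- The observations of the noisy problem in coordinates `(A, U)`: the linear observation is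
`√(1 - v) A`, the innovation `U` drives the remaining randomness `√(v + s) U` of `Z + √s W`, and
`s` is the noise variance. -/
noncomputable def innovObs (f : ℝ → ℝ) (s v : ℝ) (ω : ℝ × ℝ) : ℝ × ℝ :=
  (f (√(1 - v) * ω.1 + √(v + s) * ω.2), √(1 - v) * ω.1)

/-- The minimum mean square error of the innovation `U` given the observations `innovObs`. -/
noncomputable def mmseInnov (f : ℝ → ℝ) (s v : ℝ) : ℝ :=
  mmseGiven (stdGaussian.prod stdGaussian) (fun ω => ω.2) (innovObs f s v)

lemma measurable_innovObs (hf : Measurable f) (s v : ℝ) : Measurable (innovObs f s v) := by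
  unfold innovObs
  fun_prop

lemma memLp_snd_stdGaussian_prod :
    MemLp (fun ω : ℝ × ℝ => ω.2) 2 (stdGaussian.prod stdGaussian) :=
  memLp_id_stdGaussian.comp_snd _

-- Two reflections turn `(Z, W, N)` into independent standard Gaussians `(A, U, Q)` with
-- `Z = √(1 - v) A + √v (α U + β Q)`, where `α² = v / (v + s)` and `β² = s / (v + s)`.
lemma mmseZNoisy_eq_mmseGiven_innovation (hf : Measurable f) {s v : ℝ} (hs : 0 ≤ s) (hv : 0 < v)
    (hv1 : v ≤ 1) :
    mmseZNoisy f s v = mmseGiven ((stdGaussian.prod stdGaussian).prod stdGaussian)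
      (fun ω => √v * (√(v / (v + s)) * ω.1.2 + √(s / (v + s)) * ω.2) + √(1 - v) * ω.1.1)
      (fun ω => innovObs f s v ω.1) := by
  set α := √(v / (v + s)) with hα
  set β := √(s / (v + s)) with hβ
  have hv2 : √v ^ 2 = v := Real.sq_sqrt hv.le
  have hv2' : √(1 - v) ^ 2 = 1 - v := Real.sq_sqrt (by linarith)
  have hαβ : α ^ 2 + β ^ 2 = 1 := by
    rw [Real.sq_sqrt (by positivity), Real.sq_sqrt (by positivity)]
    field_simp
  have hU : √v * α + √s * β = √(v + s) := by
    rw [hα, hβ, Real.sqrt_div hv.le, Real.sqrt_div hs, ← mul_div_assoc, ← mul_div_assoc,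
      Real.mul_self_sqrt hv.le, Real.mul_self_sqrt hs, ← add_div]
    exact Real.div_sqrt
  have hQ : √v * β = √s * α := by
    rw [← Real.sqrt_mul hv.le, ← Real.sqrt_mul hs]
    congr 1
    ring
  have hid := MeasurePreserving.id stdGaussian
  have hΘ := (hid.prod Measure.measurePreserving_swap).comp
    ((measurePreserving_prodAssoc stdGaussian stdGaussian stdGaussian).comp
      (((measurePreserving_reflection (a := √(1 - v)) (b := √v)
        (by rw [hv2, hv2']; ring)).prod hid).comp
        (measurePreserving_reflect_noises stdGaussian hαβ)))
  rw [mmseZNoisy, ← mmseGiven_comp_measurePreserving hΘ (by fun_prop)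
    (memLp_id_stdGaussian.comp_fst _)]
  congr 1 <;> funext ⟨⟨A, U⟩, Q⟩
  · exact add_comm _ _
  · refine Prod.ext (congrArg f ?_) ?_
    · change √(1 - v) * A + √v * (α * U + β * Q) + √s * (β * U - α * Q) = _
      linear_combination U * hU + Q * hQ
    · change (1 - v) * (√(1 - v) * A + √v * (α * U + β * Q)) +
        √(v * (1 - v)) * (√v * A - √(1 - v) * (α * U + β * Q)) = √(1 - v) * A
      rw [Real.sqrt_mul hv.le]
      linear_combination √(1 - v) * A * hv2 - √v * (α * U + β * Q) * hv2'

lemma mmseZNoisy_eq_mmseInnov (hf : Measurable f) {s v : ℝ} (hs : 0 ≤ s) (hv : 0 < v)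
    (hv1 : v ≤ 1) :
    mmseZNoisy f s v = v * (v / (v + s) * mmseInnov f s v + s / (v + s)) := by
  have hT := measurable_innovObs hf s v
  have hU := memLp_snd_stdGaussian_prod.const_mul (√(v / (v + s)))
  have hsum : MemLp (fun ω : (ℝ × ℝ) × ℝ => √(v / (v + s)) * ω.1.2 + √(s / (v + s)) * ω.2) 2
      ((stdGaussian.prod stdGaussian).prod stdGaussian) :=
    (hU.comp_fst _).add ((memLp_id_stdGaussian.comp_snd _).const_mul _)
  have hdrop := mmseGiven_add_comp (T := fun ω : (ℝ × ℝ) × ℝ => innovObs f s v ω.1) (by fun_prop)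
    ((hsum.const_mul (√v)).integrable one_le_two) measurable_snd
    (((memLp_fst_stdGaussian_prod.comp_fst _).const_mul (√(1 - v))).integrable one_le_two)
  rw [mmseZNoisy_eq_mmseGiven_innovation hf hs hv hv1]
  refine hdrop.trans ?_
  rw [mmseGiven_const_mul, mmseGiven_add_indep_noise hT hU memLp_id_stdGaussian
      integral_id_gaussianReal, mmseGiven_const_mul, integral_sq_stdGaussian, Real.sq_sqrt hv.le,
    Real.sq_sqrt (by positivity), Real.sq_sqrt (by positivity), mul_one, mmseInnov]

lemma mmseInnov_le_one (hf : Measurable f) (s v : ℝ) : mmseInnov f s v ≤ 1 := by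
  refine (mmseGiven_le_integral_sq (measurable_innovObs hf s v)
    memLp_snd_stdGaussian_prod).trans_eq ?_
  rw [integral_fun_snd fun y : ℝ => y ^ 2, integral_sq_stdGaussian]
  simp

lemma mmseZNoisy_le_self (hf : Measurable f) {s v : ℝ} (hs : 0 ≤ s) (hv : 0 < v) (hv1 : v ≤ 1) :
    mmseZNoisy f s v ≤ v := by
  rw [mmseZNoisy_eq_mmseInnov hf hs hv hv1]
  calc v * (v / (v + s) * mmseInnov f s v + s / (v + s))
      ≤ v * (v / (v + s) * 1 + s / (v + s)) := by
        gcongr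
        exact mmseInnov_le_one hf s v
    _ = v := by field_simp

lemma mul_div_add_le_mmseZNoisy (hf : Measurable f) {s v : ℝ} (hs : 0 ≤ s) (hv : 0 < v)
    (hv1 : v ≤ 1) : v * (s / (v + s)) ≤ mmseZNoisy f s v := by
  have hm : 0 ≤ mmseInnov f s v := mmseGiven_nonneg
  rw [mmseZNoisy_eq_mmseInnov hf hs hv hv1]
  gcongr
  exact le_add_of_nonneg_left (by positivity)

end Innovation

section Pieces

/-- A decomposition of the line into finitely many intervals, on each of which `f` is continuous and
either injective or constant. -/
structure Pieces (f : ℝ → ℝ) where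
  /-- The number of intervals. -/
  K : ℕ
  /-- The intervals, which may be empty or degenerate. -/
  I : Fin K → Set ℝ
  ordConnected : ∀ k, (I k).OrdConnected
  pairwise_disjoint : Pairwise fun j k => Disjoint (I j) (I k)
  iUnion_eq : ⋃ k, I k = Set.univ
  continuousOn : ∀ k, ContinuousOn f (I k)
  injOn_or_const : ∀ k, Set.InjOn f (I k) ∨ ∃ c, ∀ x ∈ I k, f x = c

lemma PiecewiseSmooth.nonempty_pieces {f : ℝ → ℝ} (hf : PiecewiseSmooth f) :
    Nonempty (Pieces f) := by
  obtain ⟨⟨K, I, hord, hdisj, hcover, hI⟩, -⟩ := hf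
  refine ⟨⟨K, I, hord, hdisj, hcover, fun k => (hI k).1.continuousOn, fun k => ?_⟩⟩
  rcases (hI k).2 with hmono | hanti | hconst
  · exact Or.inl hmono.injOn
  · exact Or.inl hanti.injOn
  · exact Or.inr hconst

namespace Pieces

variable {f : ℝ → ℝ}

lemma exists_mem (D : Pieces f) (x : ℝ) : ∃ k, x ∈ D.I k :=
  Set.mem_iUnion.1 (D.iUnion_eq ▸ Set.mem_univ x)

lemma eq_of_mem (D : Pieces f) {x : ℝ} {j k : Fin D.K} (hj : x ∈ D.I j) (hk : x ∈ D.I k) :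
    j = k :=
  by_contra fun h => Set.disjoint_left.1 (D.pairwise_disjoint h) hj hk

lemma measurable (D : Pieces f) : Measurable f := by
  intro t ht
  have hpre : f ⁻¹' t = ⋃ k, Subtype.val '' ((D.I k).domRestrict f ⁻¹' t) := by
    ext x
    obtain ⟨k, hk⟩ := D.exists_mem x
    simp only [Set.mem_preimage, Set.mem_iUnion, Set.mem_image]
    exact ⟨fun h => ⟨k, ⟨x, hk⟩, h, rfl⟩, fun ⟨_, _, h, hx⟩ => hx ▸ h⟩
  rw [hpre]
  refine MeasurableSet.iUnion fun k => (D.ordConnected k).measurableSet.subtype_image ?_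
  exact (continuousOn_iff_continuous_domRestrict.1 (D.continuousOn k)).measurable ht

/-- The union of the pieces on which `f` is injective. -/
def injSet (D : Pieces f) : Set ℝ := ⋃ k ∈ {k | Set.InjOn f (D.I k)}, D.I k

/-- The probability that a standard Gaussian falls in a piece on which `f` is injective; this is
the information dimension of `f(Z)`. -/
noncomputable def p (D : Pieces f) : ℝ := stdGaussian.real D.injSet

lemma measurableSet_injSet (D : Pieces f) : MeasurableSet D.injSet :=
  MeasurableSet.biUnion (Set.to_countable _) fun k _ => (D.ordConnected k).measurableSet

lemma mem_injSet_iff (D : Pieces f) {x : ℝ} {k : Fin D.K} (hk : x ∈ D.I k) :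
    x ∈ D.injSet ↔ Set.InjOn f (D.I k) := by
  simp only [injSet, Set.mem_iUnion, Set.mem_ofPred_eq]
  exact ⟨fun ⟨_, hj, hx⟩ => D.eq_of_mem hk hx ▸ hj, fun h => ⟨k, h, hk⟩⟩

lemma ae_mem_interior (D : Pieces f) : ∀ᵐ x ∂stdGaussian, ∃ k, x ∈ interior (D.I k) := by
  have hfrontier : ∀ᵐ x ∂stdGaussian, ∀ k, x ∉ frontier (D.I k) :=
    ae_all_iff.2 fun k => measure_eq_zero_iff_ae_notMem.1
      (gaussianReal_absolutelyContinuous 0 one_ne_zero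
        ((D.ordConnected k).convex.addHaar_frontier volume))
  filter_upwards [hfrontier] with x hx
  obtain ⟨k, hk⟩ := D.exists_mem x
  exact ⟨k, by_contra fun hi => hx k ⟨subset_closure hk, hi⟩⟩

lemma ae_continuousAt (D : Pieces f) : ∀ᵐ x ∂stdGaussian, ContinuousAt f x := by
  filter_upwards [D.ae_mem_interior] with x ⟨k, hk⟩
  exact (D.continuousOn k).continuousAt (mem_interior_iff_mem_nhds.1 hk)

lemma exists_leftInverse (D : Pieces f) {k : Fin D.K} (hk : Set.InjOn f (D.I k)) :
    ∃ g : ℝ → ℝ, Measurable g ∧ ∀ x ∈ D.I k, g (f x) = x := by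
  have : StandardBorelSpace (D.I k) := (D.ordConnected k).measurableSet.standardBorel
  have hm : MeasurableEmbedding ((D.I k).domRestrict f) :=
    Measurable.measurableEmbedding (D.measurable.comp measurable_subtype_coe) hk.injective
  obtain ⟨g, hg, hgf⟩ := hm.exists_measurable_extend measurable_subtype_coe fun _ => ⟨0⟩
  exact ⟨g, hg, fun x hx => congrFun hgf ⟨x, hx⟩⟩

-- The second argument of `g` tells in which piece the point to be recovered lies.
lemma exists_decoder (D : Pieces f) :
    ∃ g : ℝ × ℝ → ℝ, Measurable g ∧ ∀ k, ∀ x ∈ D.I k, ∀ b ∈ D.I k,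
      (b ∈ D.injSet → g (f x, b) = x) ∧ (b ∉ D.injSet → g (f x, b) = b) := by
  have hpiece (k : Fin D.K) : ∃ g : ℝ × ℝ → ℝ, Measurable g ∧ ∀ x ∈ D.I k, ∀ b ∈ D.I k,
      (b ∈ D.injSet → g (f x, b) = x) ∧ (b ∉ D.injSet → g (f x, b) = b) := by
    by_cases hk : Set.InjOn f (D.I k)
    · obtain ⟨g, hg, hgf⟩ := D.exists_leftInverse hk
      exact ⟨fun y => g y.1, by fun_prop, fun x hx b hb =>
        ⟨fun _ => hgf x hx, fun hn => absurd ((D.mem_injSet_iff hb).2 hk) hn⟩⟩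
    · exact ⟨Prod.snd, measurable_snd, fun x _ b hb =>
        ⟨fun hi => absurd ((D.mem_injSet_iff hb).1 hi) hk, fun _ => rfl⟩⟩
  choose g hg hgf using hpiece
  refine ⟨fun y => ∑ k, (Prod.snd ⁻¹' D.I k).indicator (g k) y,
    Finset.measurable_fun_sum _ fun k _ =>
      (hg k).indicator (measurable_snd (D.ordConnected k).measurableSet), fun k x hx b hb => ?_⟩
  have hsum : ∑ j, (Prod.snd ⁻¹' D.I j).indicator (g j) (f x, b) = g k (f x, b) := by
    refine (Finset.sum_eq_single_of_mem k (Finset.mem_univ k) fun j _ hj => ?_).trans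
      (Set.indicator_of_mem (s := Prod.snd ⁻¹' D.I k) hb _)
    exact Set.indicator_of_notMem (s := Prod.snd ⁻¹' D.I j)
      (fun hbj => hj (D.eq_of_mem hbj hb)) _
  simpa only [hsum] using hgf k x hx b hb

end Pieces

end Pieces

section SmallVariance

variable {f : ℝ → ℝ}

/-- The admissible pairs `(v, s)` of an error variance and a noise variance. -/
def variancePairs : Set (ℝ × ℝ) := {x | 0 < x.1 ∧ x.1 ≤ 1 ∧ 0 ≤ x.2}

lemma setIntegral_fst_mem_snd_sq (S : Set ℝ) :
    ∫ ω in Prod.fst ⁻¹' S, ω.2 ^ 2 ∂(stdGaussian.prod stdGaussian) = stdGaussian.real S := by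
  rw [← Set.prod_univ, ← Measure.prod_restrict, Measure.restrict_univ,
    integral_fun_snd fun y : ℝ => y ^ 2, integral_sq_stdGaussian]
  simp

namespace Pieces

/-- The points `ω = (A, U)` for which the segment between `√(1 - v) A ± √(v + s) U` lies in a piece
on which `f` is constant, so that the sign of `U` cannot be observed. -/
def blindSet (D : Pieces f) (s v : ℝ) : Set (ℝ × ℝ) :=
  {ω | ∃ k, ¬ Set.InjOn f (D.I k) ∧ √(1 - v) * ω.1 + √(v + s) * ω.2 ∈ D.I k ∧
    √(1 - v) * ω.1 + √(v + s) * -ω.2 ∈ D.I k}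

lemma measurableSet_blindSet (D : Pieces f) (s v : ℝ) : MeasurableSet (D.blindSet s v) := by
  simp only [blindSet, Set.ofPred_exists, Set.ofPred_and]
  exact MeasurableSet.iUnion fun k => (MeasurableSet.const _).inter
    ((measurableSet_preimage (by fun_prop) (D.ordConnected k).measurableSet).inter
      (measurableSet_preimage (by fun_prop) (D.ordConnected k).measurableSet))

lemma setIntegral_blindSet_le_mmseInnov (D : Pieces f) (s v : ℝ) :
    ∫ ω in D.blindSet s v, ω.2 ^ 2 ∂(stdGaussian.prod stdGaussian) ≤ mmseInnov f s v := by
  refine setIntegral_sq_le_mmseGiven memLp_snd_stdGaussian_prod (D.measurableSet_blindSet s v)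
    ((MeasurePreserving.id stdGaussian).prod measurePreserving_neg_stdGaussian) ?_ ?_
    fun ω _ => rfl
  · ext ω
    simp only [blindSet, Set.mem_preimage, Set.mem_ofPred_eq, Prod.map_fst, Prod.map_snd, id_eq,
      neg_neg]
    exact exists_congr fun k => and_congr_right fun _ => and_comm
  · rintro ω ⟨k, hk, hplus, hminus⟩
    obtain ⟨c, hc⟩ := (D.injOn_or_const k).resolve_left hk
    simp only [innovObs, Prod.map_fst, Prod.map_snd, id_eq, hc _ hplus, hc _ hminus]

lemma eventually_mem_piece (D : Pieces f) {a : ℝ} {k : Fin D.K} (ha : a ∈ interior (D.I k))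
    (u : ℝ) :
    ∀ᶠ x : ℝ × ℝ in 𝓝[variancePairs] (0, 0), √(1 - x.1) * a + √(x.1 + x.2) * u ∈ D.I k := by
  have hcont : ContinuousAt (fun x : ℝ × ℝ => √(1 - x.1) * a + √(x.1 + x.2) * u) (0, 0) := by
    fun_prop
  refine (hcont.mono_left nhdsWithin_le_nhds).eventually ?_
  simpa using mem_interior_iff_mem_nhds.1 ha

lemma ae_fst_mem_interior (D : Pieces f) :
    ∀ᵐ ω ∂(stdGaussian.prod stdGaussian), ∃ k, ω.1 ∈ interior (D.I k) :=
  measurePreserving_fst.quasiMeasurePreserving.ae D.ae_mem_interior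

lemma tendsto_setIntegral_blindSet (D : Pieces f) :
    Tendsto (fun x : ℝ × ℝ => ∫ ω in D.blindSet x.2 x.1, ω.2 ^ 2 ∂(stdGaussian.prod stdGaussian))
      (𝓝[variancePairs] (0, 0)) (𝓝 (1 - D.p)) := by
  rw [p, ← probReal_compl_eq_one_sub D.measurableSet_injSet,
    ← setIntegral_fst_mem_snd_sq D.injSetᶜ]
  simp_rw [← integral_indicator (D.measurableSet_blindSet _ _),
    ← integral_indicator (measurable_fst D.measurableSet_injSet.compl)]
  refine tendsto_integral_filter_of_dominated_convergence (fun ω => ω.2 ^ 2)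
    (Eventually.of_forall fun x => ((measurable_snd.pow_const 2).indicator
      (D.measurableSet_blindSet _ _)).aestronglyMeasurable)
    (Eventually.of_forall fun x => ae_of_all _ fun ω =>
      (norm_indicator_le_norm_self _ _).trans_eq (Real.norm_of_nonneg (sq_nonneg _)))
    memLp_snd_stdGaussian_prod.integrable_sq ?_
  filter_upwards [D.ae_fst_mem_interior] with ω ⟨k, hk⟩
  refine tendsto_const_nhds.congr' ?_
  filter_upwards [D.eventually_mem_piece hk ω.2, D.eventually_mem_piece hk (-ω.2)] with x hx hx'
  have hiff : ω ∈ Prod.fst ⁻¹' D.injSetᶜ ↔ ω ∈ D.blindSet x.2 x.1 := by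
    rw [Set.mem_preimage, Set.mem_compl_iff, D.mem_injSet_iff (interior_subset hk)]
    exact ⟨fun h => ⟨k, h, hx, hx'⟩, fun ⟨j, hj, hxj, _⟩ => D.eq_of_mem hxj hx ▸ hj⟩
  by_cases hω : ω ∈ D.blindSet x.2 x.1
  · rw [Set.indicator_of_mem hω, Set.indicator_of_mem (hiff.2 hω)]
  · rw [Set.indicator_of_notMem hω, Set.indicator_of_notMem (mt hiff.1 hω)]

/-- What the observations tell about `U` in the limit of vanishing variances: `U` itself if
`A` lies in a piece on which `f` is injective, and nothing otherwise. -/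
noncomputable def revealed (D : Pieces f) : ℝ × ℝ → ℝ :=
  (Prod.fst ⁻¹' D.injSet).indicator Prod.snd

lemma measurable_revealed (D : Pieces f) : Measurable D.revealed :=
  measurable_snd.indicator (measurable_fst D.measurableSet_injSet)

lemma mmseGiven_revealed_le (D : Pieces f) :
    mmseGiven (stdGaussian.prod stdGaussian) (fun ω => ω.2) D.revealed ≤ 1 - D.p := by
  have hS : MeasurableSet (Prod.fst ⁻¹' D.injSet : Set (ℝ × ℝ)) :=
    measurable_fst D.measurableSet_injSet
  refine (mmseGiven_le D.measurable_revealed memLp_snd_stdGaussian_prod measurable_id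
    (memLp_snd_stdGaussian_prod.indicator hS)).trans_eq ?_
  rw [p, ← probReal_compl_eq_one_sub D.measurableSet_injSet,
    ← setIntegral_fst_mem_snd_sq D.injSetᶜ, Set.preimage_compl,
    ← integral_indicator hS.compl]
  congr 1 with ω
  by_cases hω : ω ∈ Prod.fst ⁻¹' D.injSet <;> simp [revealed, hω]

lemma ae_eventually_decode_eq_revealed (D : Pieces f) {g : ℝ × ℝ → ℝ}
    (hg : ∀ k, ∀ x ∈ D.I k, ∀ b ∈ D.I k,
      (b ∈ D.injSet → g (f x, b) = x) ∧ (b ∉ D.injSet → g (f x, b) = b)) :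
    ∀ᵐ ω ∂(stdGaussian.prod stdGaussian), ∀ᶠ x : ℝ × ℝ in 𝓝[variancePairs] (0, 0),
      (g (innovObs f x.2 x.1 ω) - (innovObs f x.2 x.1 ω).2) / √(x.1 + x.2) = D.revealed ω := by
  filter_upwards [D.ae_fst_mem_interior] with ω ⟨k, hk⟩
  filter_upwards [D.eventually_mem_piece hk ω.2, D.eventually_mem_piece hk 0,
    self_mem_nhdsWithin] with x hx hx₀ ⟨hv, _, hs⟩
  rw [mul_zero, add_zero] at hx₀
  have hiff : ω ∈ Prod.fst ⁻¹' D.injSet ↔ √(1 - x.1) * ω.1 ∈ D.injSet := by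
    rw [Set.mem_preimage, D.mem_injSet_iff (interior_subset hk), D.mem_injSet_iff hx₀]
  obtain ⟨hinj, hconst⟩ := hg k _ hx _ hx₀
  by_cases hω : ω ∈ Prod.fst ⁻¹' D.injSet
  · simp only [revealed, innovObs, Set.indicator_of_mem hω, hinj (hiff.1 hω)]
    field_simp
    ring
  · simp only [revealed, innovObs, Set.indicator_of_notMem hω,
      hconst (fun h => hω (hiff.2 h)), sub_self, zero_div]

lemma eventually_mmseInnov_lt (D : Pieces f) {c : ℝ} (hc : 1 - D.p < c) :
    ∀ᶠ x : ℝ × ℝ in 𝓝[variancePairs] (0, 0), mmseInnov f x.2 x.1 < c := by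
  obtain ⟨g, hg, hgf⟩ := D.exists_decoder
  let decode (x : ℝ × ℝ) (y : ℝ × ℝ) : ℝ := (g y - y.2) / √(x.1 + x.2)
  have hobs (x : ℝ × ℝ) := measurable_innovObs D.measurable x.2 x.1
  have hdec (x : ℝ × ℝ) : Measurable (decode x) := by fun_prop
  have hlim : ∀ᵐ ω ∂(stdGaussian.prod stdGaussian),
      Tendsto (fun x => decode x (innovObs f x.2 x.1 ω)) (𝓝[variancePairs] (0, 0))
        (𝓝 (D.revealed ω)) := by
    filter_upwards [D.ae_eventually_decode_eq_revealed hgf] with ω hω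
    exact tendsto_nhds_of_eventually_eq hω
  filter_upwards [eventually_mmseGiven_lt (fun x => (hdec x).comp (hobs x)) D.measurable_revealed
    memLp_snd_stdGaussian_prod hlim (D.mmseGiven_revealed_le.trans_lt hc)] with x hx
  exact (mmseGiven_le_mmseGiven_comp (hobs x) memLp_snd_stdGaussian_prod (hdec x)).trans_lt hx

lemma tendsto_mmseInnov (D : Pieces f) :
    Tendsto (fun x : ℝ × ℝ => mmseInnov f x.2 x.1) (𝓝[variancePairs] (0, 0)) (𝓝 (1 - D.p)) := by
  refine tendsto_order.2 ⟨fun c hc => ?_, fun c hc => D.eventually_mmseInnov_lt hc⟩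
  filter_upwards [D.tendsto_setIntegral_blindSet.eventually_const_lt hc] with x hx
  exact hx.trans_le (D.setIntegral_blindSet_le_mmseInnov _ _)

lemma tendsto_mmseZNoisy_div_self (D : Pieces f) :
    Tendsto (fun x : ℝ × ℝ => mmseZNoisy f x.2 x.1 / x.1 - (1 - D.p * (x.1 / (x.1 + x.2))))
      (𝓝[variancePairs] (0, 0)) (𝓝 0) := by
  refine squeeze_zero_norm' ?_
    (tendsto_iff_norm_sub_tendsto_zero.1 D.tendsto_mmseInnov)
  filter_upwards [self_mem_nhdsWithin] with x ⟨hv, hv1, hs⟩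
  have hvs : 0 < x.1 + x.2 := by linarith
  have herr : mmseZNoisy f x.2 x.1 / x.1 - (1 - D.p * (x.1 / (x.1 + x.2))) =
      x.1 / (x.1 + x.2) * (mmseInnov f x.2 x.1 - (1 - D.p)) := by
    rw [mmseZNoisy_eq_mmseInnov D.measurable hs hv hv1]
    field_simp
    ring
  rw [herr, norm_mul, Real.norm_of_nonneg (by positivity)]
  exact mul_le_of_le_one_left (norm_nonneg _) ((div_le_one hvs).2 (by linarith))

lemma eventually_mmseZNoisy_lt (D : Pieces f) {v₀ c : ℝ} (hv₀ : 0 < v₀) (hv₀1 : v₀ ≤ 1)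
    (hc : mmseZ f v₀ < c) :
    ∀ᶠ x : ℝ × ℝ in 𝓝[variancePairs] (v₀, 0), mmseZNoisy f x.2 x.1 < c := by
  have hf := D.measurable
  let T (x : ℝ × ℝ) (ω : (ℝ × ℝ) × ℝ) : ℝ × ℝ :=
    (√(x.1⁻¹ - 1) * ω.1.1 + ω.2, f (ω.1.1 + √x.2 * ω.1.2))
  have hT (x : ℝ × ℝ) : Measurable (T x) := by fun_prop
  have hae : ∀ᵐ ω ∂((stdGaussian.prod stdGaussian).prod stdGaussian), ContinuousAt f ω.1.1 :=
    (measurePreserving_fst.comp measurePreserving_fst).quasiMeasurePreserving.ae D.ae_continuousAt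
  have hlim : ∀ᵐ ω ∂((stdGaussian.prod stdGaussian).prod stdGaussian),
      Tendsto (fun x => T x ω) (𝓝[variancePairs] (v₀, 0)) (𝓝 (T (v₀, 0) ω)) := by
    filter_upwards [hae] with ω hω
    have hinner : ContinuousAt (fun x : ℝ × ℝ => ω.1.1 + √x.2 * ω.1.2) (v₀, 0) := by fun_prop
    have hchannel : ContinuousAt (fun x : ℝ × ℝ => √(x.1⁻¹ - 1) * ω.1.1 + ω.2) (v₀, 0) := by
      have := hv₀.ne'
      fun_prop (disch := assumption)
    exact (hchannel.prodMk (ContinuousAt.comp (by simpa using hω) hinner)).mono_left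
      nhdsWithin_le_nhds
  rw [← mmseZNoisy_zero hf hv₀ hv₀1, mmseZNoisy_eq_channelMMSE hf 0 hv₀ hv₀1] at hc
  filter_upwards [eventually_mmseGiven_lt hT (hT (v₀, 0))
    (memLp_fst_stdGaussian_prod.comp_fst stdGaussian) hlim hc, self_mem_nhdsWithin]
    with x hx ⟨hv, hv1, _⟩
  rwa [mmseZNoisy_eq_channelMMSE hf _ hv hv1]

end Pieces

end SmallVariance

section Dimension

lemma entropy_le_card {ν : Measure ℤ} {S : Finset ℤ}
    (hS : ν (S : Set ℤ)ᶜ = 0) : entropy ν ≤ S.card := by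
  have hsupp (k : ℤ) (hk : k ∉ S) : ENNReal.ofReal (Real.negMulLog (ν.real {k})) = 0 := by
    have hzero : ν {k} = 0 := measure_mono_null (by simpa using hk) hS
    simp [Measure.real, hzero]
  rw [entropy, tsum_eq_sum hsupp]
  refine (Finset.sum_le_card_nsmul _ _ 1 fun k _ => ?_).trans (by simp)
  refine ENNReal.ofReal_le_one.2 ?_
  exact (Real.negMulLog_le_one_sub_self measureReal_nonneg).trans (by simp)

lemma quantizedEntropy_le_card {ν : Measure ℝ} {S : Finset ℝ}
    (hS : ν (S : Set ℝ)ᶜ = 0) (M : ℕ) : quantizedEntropy ν M ≤ S.card := by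
  classical
  have hm : Measurable fun x : ℝ => ⌊(M : ℝ) * x⌋ := by fun_prop
  refine (entropy_le_card (S := S.image fun x => ⌊(M : ℝ) * x⌋) ?_).trans
    (Nat.cast_le.2 Finset.card_image_le)
  rw [Measure.map_apply hm (.of_discrete)]
  exact measure_mono_null
    (fun x hx hxS => hx (Finset.mem_coe.2 (Finset.mem_image_of_mem _ hxS))) hS

lemma informationDimension_eq_zero {ν : Measure ℝ} {S : Finset ℝ}
    (hS : ν (S : Set ℝ)ᶜ = 0) {d : ℝ≥0} (hd : HasInformationDimension ν d) : d = 0 := by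
  have hlog : Tendsto (fun M : ℕ => ENNReal.ofReal (Real.log M)) atTop (𝓝 ∞) :=
    ENNReal.tendsto_ofReal_atTop.comp (Real.tendsto_log_atTop.comp tendsto_natCast_atTop_atTop)
  have hbound : Tendsto (fun M : ℕ => (S.card : ℝ≥0∞) / ENNReal.ofReal (Real.log M)) atTop
      (𝓝 0) := by
    simpa using ENNReal.Tendsto.const_div hlog (Or.inr (ENNReal.natCast_ne_top S.card))
  have hzero := tendsto_of_tendsto_of_tendsto_of_le_of_le tendsto_const_nhds hbound
    (fun M => zero_le) fun M => ENNReal.div_le_div_right (quantizedEntropy_le_card hS M) _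
  exact_mod_cast tendsto_nhds_unique hd hzero

-- Otherwise `f(Z)` would almost surely take one of the finitely many values of the constant pieces.
lemma Pieces.p_pos {f : ℝ → ℝ} (D : Pieces f) {d : ℝ≥0}
    (hd : HasInformationDimension (outputLaw f) d) (hd0 : d ≠ 0) : 0 < D.p := by
  classical
  refine measureReal_nonneg.lt_of_ne fun hp => hd0 ?_
  have hnull : stdGaussian D.injSet = 0 := (measureReal_eq_zero_iff).1 hp.symm
  have hconst (k : {k // ¬ Set.InjOn f (D.I k)}) : ∃ c, ∀ x ∈ D.I k, f x = c :=
    (D.injOn_or_const k).resolve_left k.2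
  choose c hc using hconst
  refine informationDimension_eq_zero (S := Finset.univ.image c) ?_ hd
  rw [outputLaw, Measure.map_apply D.measurable (Finset.measurableSet _).compl]
  refine measure_mono_null (fun x hx => by_contra fun hx' => hx ?_) hnull
  obtain ⟨k, hk⟩ := D.exists_mem x
  have hk' : ¬ Set.InjOn f (D.I k) := mt (D.mem_injSet_iff hk).2 hx'
  rw [hc ⟨k, hk'⟩ x hk]
  exact Finset.mem_coe.2 (Finset.mem_image_of_mem _ (Finset.mem_univ _))

end Dimension

section Spectral

/-- `E[λ / (1 + λ w)]`, the denominator in `Φ(1 / w)`. -/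
noncomputable def specF (P : Measure ℝ) (w : ℝ) : ℝ := ∫ x, (w + x⁻¹)⁻¹ ∂P

/-- `E[1 / (1 + λ w)]`, which is `mse P V` in terms of the precision `w = 1 / V`. -/
noncomputable def specMu (P : Measure ℝ) (w : ℝ) : ℝ := ∫ x, (1 + x * w)⁻¹ ∂P

/-- `1 / Φ(1 / w)`, the map `Φ` in terms of precisions. -/
noncomputable def specPsi (P : Measure ℝ) (δ w : ℝ) : ℝ := δ / specF P w - w

lemma extrinsic_eq {m v : ℝ} (hm : 0 < m) (hv : 0 < v) :
    extrinsic m v = (ENNReal.ofReal (m⁻¹ - v⁻¹))⁻¹ := by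
  rw [extrinsic, ← ENNReal.ofReal_inv_of_pos hm, ← ENNReal.ofReal_inv_of_pos hv,
    ← ENNReal.ofReal_sub _ (by positivity)]

lemma integrable_mse (P : Measure ℝ) [IsFiniteMeasure P] (V : ℝ≥0∞) :
    Integrable (fun x => ((1 + ENNReal.ofReal x / V)⁻¹).toReal) P := by
  have hm : Measurable fun x : ℝ => ((1 + ENNReal.ofReal x / V)⁻¹).toReal := by fun_prop
  refine Integrable.of_bound hm.aestronglyMeasurable 1 (ae_of_all _ fun x => ?_)
  rw [Real.norm_of_nonneg ENNReal.toReal_nonneg]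
  exact ENNReal.toReal_le_of_le_ofReal zero_le_one
    (by simp)

lemma mse_mono (P : Measure ℝ) [IsFiniteMeasure P] {V V' : ℝ≥0∞} (hV : V ≤ V') :
    mse P V ≤ mse P V' := by
  refine integral_mono (integrable_mse P V) (integrable_mse P V') fun x => ?_
  refine ENNReal.toReal_mono (by simp) ?_
  gcongr

lemma mse_nonneg (P : Measure ℝ) (V : ℝ≥0∞) : 0 ≤ mse P V :=
  integral_nonneg fun _ => ENNReal.toReal_nonneg

lemma eq_zero_of_mse_eq_zero {P : Measure ℝ} [IsFiniteMeasure P] [NeZero P] {V : ℝ≥0∞}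
    (h : mse P V = 0) : V = 0 := by
  by_contra hV
  have hpos (x : ℝ) : 0 < ((1 + ENNReal.ofReal x / V)⁻¹).toReal := by
    refine ENNReal.toReal_pos (ENNReal.inv_ne_zero.2 ?_) (by simp)
    exact ENNReal.add_ne_top.2 ⟨ENNReal.one_ne_top, ENNReal.div_ne_top ENNReal.ofReal_ne_top hV⟩
  have hzero := (integral_eq_zero_iff_of_nonneg (fun x => ENNReal.toReal_nonneg)
    (integrable_mse P V)).1 h
  obtain ⟨x, hx⟩ := hzero.exists
  exact (hpos x).ne' hx

namespace IsSpectralLaw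

variable {P : Measure ℝ} {δ w w' : ℝ}

lemma pos (hP : IsSpectralLaw P δ) : 0 < δ := zero_lt_one.trans hP.one_lt

lemma ae_pos (hP : IsSpectralLaw P δ) : ∀ᵐ x ∂P, 0 < x := by
  obtain ⟨a, b, ha, hab⟩ := hP.support
  filter_upwards [hab] with x hx using ha.trans_le hx.1

lemma exists_ae_norm_specF_integrand_le (hP : IsSpectralLaw P δ) :
    ∃ b, ∀ w, 0 ≤ w → ∀ᵐ x ∂P, ‖(w + x⁻¹)⁻¹‖ ≤ b := by
  obtain ⟨a, b, _, hab⟩ := hP.support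
  refine ⟨b, fun w hw => ?_⟩
  filter_upwards [hab, hP.ae_pos] with x hx hx0
  rw [Real.norm_of_nonneg (by positivity)]
  exact (inv_le_of_inv_le₀ hx0 (by linarith)).trans hx.2

lemma integrable_specF (hP : IsSpectralLaw P δ) (hw : 0 ≤ w) :
    Integrable (fun x => (w + x⁻¹)⁻¹) P := by
  have := hP.isProb
  obtain ⟨b, hb⟩ := hP.exists_ae_norm_specF_integrand_le
  have hm : Measurable fun x : ℝ => (w + x⁻¹)⁻¹ := by fun_prop
  exact Integrable.of_bound hm.aestronglyMeasurable b (hb w hw)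

lemma integrable_specMu (hP : IsSpectralLaw P δ) (hw : 0 ≤ w) :
    Integrable (fun x => (1 + x * w)⁻¹) P := by
  have := hP.isProb
  have hm : Measurable fun x : ℝ => (1 + x * w)⁻¹ := by fun_prop
  refine Integrable.of_bound hm.aestronglyMeasurable 1 ?_
  filter_upwards [hP.ae_pos] with x hx
  rw [Real.norm_of_nonneg (by positivity)]
  exact inv_le_one_of_one_le₀ (le_add_of_nonneg_right (by positivity))

lemma mul_specF (hP : IsSpectralLaw P δ) (hw : 0 ≤ w) : w * specF P w = 1 - specMu P w := by
  have := hP.isProb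
  calc w * specF P w = ∫ x, w * (w + x⁻¹)⁻¹ ∂P := (integral_const_mul _ _).symm
    _ = ∫ x, (1 - (1 + x * w)⁻¹) ∂P := by
      refine integral_congr_ae ?_
      filter_upwards [hP.ae_pos] with x hx
      have : 0 < 1 + x * w := by positivity
      have : 0 < x * w + 1 := by positivity
      field_simp
      ring
    _ = 1 - specMu P w := by
      rw [integral_sub (integrable_const _) (hP.integrable_specMu hw), specMu]
      simp

lemma exists_le_specF (hP : IsSpectralLaw P δ) :
    ∃ a, 0 < a ∧ ∀ w, 0 ≤ w → (w + a⁻¹)⁻¹ ≤ specF P w := by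
  have := hP.isProb
  obtain ⟨a, b, ha, hab⟩ := hP.support
  refine ⟨a, ha, fun w hw => ?_⟩
  calc (w + a⁻¹)⁻¹ = ∫ _, (w + a⁻¹)⁻¹ ∂P := by simp
    _ ≤ specF P w := by
      refine integral_mono_ae (integrable_const _) (hP.integrable_specF hw) ?_
      filter_upwards [hab, hP.ae_pos] with x hx hx0
      have := hx.1
      gcongr

lemma specF_pos (hP : IsSpectralLaw P δ) (hw : 0 ≤ w) : 0 < specF P w := by
  obtain ⟨a, ha, hle⟩ := hP.exists_le_specF
  exact lt_of_lt_of_le (by positivity) (hle w hw)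

lemma specF_zero (hP : IsSpectralLaw P δ) : specF P 0 = δ := by
  simp [specF, hP.mean]

lemma specMu_nonneg (hP : IsSpectralLaw P δ) (hw : 0 ≤ w) : 0 ≤ specMu P w := by
  refine integral_nonneg_of_ae ?_
  filter_upwards [hP.ae_pos] with x hx
  positivity

lemma specMu_anti (hP : IsSpectralLaw P δ) (hw : 0 ≤ w) (hww' : w ≤ w') :
    specMu P w' ≤ specMu P w := by
  refine integral_mono_ae (hP.integrable_specMu (hw.trans hww')) (hP.integrable_specMu hw) ?_
  filter_upwards [hP.ae_pos] with x hx
  gcongr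

lemma specMu_le_one (hP : IsSpectralLaw P δ) (hw : 0 ≤ w) : specMu P w ≤ 1 := by
  have := hP.isProb
  exact (hP.specMu_anti le_rfl hw).trans_eq (by simp [specMu])

lemma specPsi_eq (hP : IsSpectralLaw P δ) (hw : 0 ≤ w) :
    specPsi P δ w = (δ - 1 + specMu P w) / specF P w := by
  have hF := hP.specF_pos hw
  rw [specPsi, eq_div_iff hF.ne', sub_mul, div_mul_cancel₀ _ hF.ne', hP.mul_specF hw]
  ring

-- The integrand `B ↦ B / (1 + h B)` is concave, hence lies below its tangent at `B = E[B]`.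
lemma specF_mul_le (hP : IsSpectralLaw P δ) (hw : 0 ≤ w) (hww' : w ≤ w') :
    specF P w' * (1 + (w' - w) * specF P w) ≤ specF P w := by
  have := hP.isProb
  have hb : 0 < specF P w := hP.specF_pos hw
  have hint := hP.integrable_specF hw
  set b := specF P w with hb_def
  set h := w' - w with hh_def
  have hh : 0 ≤ h := sub_nonneg.2 hww'
  have hint' : Integrable (fun x => ((w + x⁻¹)⁻¹ - b) / (1 + h * b) ^ 2) P :=
    (hint.sub (integrable_const _)).div_const _
  have htangent : ∀ᵐ x ∂P,
      (w' + x⁻¹)⁻¹ ≤ b / (1 + h * b) + ((w + x⁻¹)⁻¹ - b) / (1 + h * b) ^ 2 := by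
    filter_upwards [hP.ae_pos] with x hx
    obtain ⟨B, hB, hBx⟩ : ∃ B, 0 < B ∧ B⁻¹ = w + x⁻¹ :=
      ⟨(w + x⁻¹)⁻¹, by positivity, inv_inv _⟩
    have hw'x : w' + x⁻¹ = B⁻¹ + h := by rw [hBx, hh_def]; ring
    have hgap : b / (1 + h * b) + (B - b) / (1 + h * b) ^ 2 - (B⁻¹ + h)⁻¹ =
        h * (B - b) ^ 2 / ((1 + h * b) ^ 2 * (1 + h * B)) := by
      field_simp
      ring
    rw [hw'x, ← hBx, inv_inv, ← sub_nonneg, hgap]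
    positivity
  rw [← le_div_iff₀ (by positivity)]
  calc specF P w' ≤ ∫ x, (b / (1 + h * b) + ((w + x⁻¹)⁻¹ - b) / (1 + h * b) ^ 2) ∂P :=
        integral_mono_ae (hP.integrable_specF (hw.trans hww'))
          ((integrable_const _).add hint') htangent
    _ = b / (1 + h * b) + ((∫ x, (w + x⁻¹)⁻¹ ∂P) - b) / (1 + h * b) ^ 2 := by
        rw [integral_add (integrable_const _) hint', integral_div ((1 + h * b) ^ 2),
          integral_sub hint (integrable_const _)]
        simp
    _ = b / (1 + h * b) := by rw [← specF, ← hb_def, sub_self, zero_div, add_zero]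

lemma specPsi_mono (hP : IsSpectralLaw P δ) (hw : 0 ≤ w) (hww' : w ≤ w') :
    specPsi P δ w ≤ specPsi P δ w' := by
  have hF := hP.specF_pos hw
  have hF' := hP.specF_pos (hw.trans hww')
  have hδ := hP.one_lt
  have hinv : (specF P w)⁻¹ + (w' - w) ≤ (specF P w')⁻¹ := by
    rw [← one_div (specF P w'), le_div_iff₀ hF', ← mul_le_mul_iff_right₀ hF]
    calc specF P w * (((specF P w)⁻¹ + (w' - w)) * specF P w')
        = specF P w' * (1 + (w' - w) * specF P w) := by field_simp
      _ ≤ specF P w * 1 := (hP.specF_mul_le hw hww').trans_eq (mul_one _).symm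
  simp only [specPsi, div_eq_mul_inv]
  nlinarith [mul_le_mul_of_nonneg_left hinv hP.pos.le]

lemma one_le_specPsi (hP : IsSpectralLaw P δ) (hw : 0 ≤ w) : 1 ≤ specPsi P δ w := by
  refine le_trans ?_ (hP.specPsi_mono le_rfl hw)
  rw [specPsi, hP.specF_zero, div_self hP.pos.ne', sub_zero]

lemma le_specPsi (hP : IsSpectralLaw P δ) (hw : 0 ≤ w) : (δ - 1) * w ≤ specPsi P δ w := by
  rw [hP.specPsi_eq hw, le_div_iff₀ (hP.specF_pos hw), mul_assoc, hP.mul_specF hw]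
  nlinarith [hP.specMu_nonneg hw, hP.one_lt]

lemma exists_specPsi_le (hP : IsSpectralLaw P δ) :
    ∃ B, ∀ w, 0 ≤ w → specPsi P δ w ≤ (δ - 1) * w + B := by
  obtain ⟨a, ha, hle⟩ := hP.exists_le_specF
  refine ⟨δ * a⁻¹, fun w hw => ?_⟩
  have hinv : (specF P w)⁻¹ ≤ w + a⁻¹ := inv_le_of_inv_le₀ (by positivity) (hle w hw)
  rw [specPsi, div_eq_mul_inv]
  linarith [mul_le_mul_of_nonneg_left hinv hP.pos.le]

lemma specPsi_inv_mul (hP : IsSpectralLaw P δ) (hw : 0 ≤ w) :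
    (specPsi P δ w)⁻¹ * w = (1 - specMu P w) / (δ - 1 + specMu P w) := by
  rw [hP.specPsi_eq hw, ← hP.mul_specF hw, inv_div, div_mul_eq_mul_div, mul_comm]

lemma continuousOn_specF (hP : IsSpectralLaw P δ) : ContinuousOn (specF P) (Set.Ici 0) := by
  have := hP.isProb
  obtain ⟨b, hb⟩ := hP.exists_ae_norm_specF_integrand_le
  have hm (w : ℝ) : Measurable fun x : ℝ => (w + x⁻¹)⁻¹ := by fun_prop
  refine continuousOn_of_dominated (bound := fun _ => b) (fun w _ => (hm w).aestronglyMeasurable)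
    hb (integrable_const _) ?_
  filter_upwards [hP.ae_pos] with x hx
  refine ContinuousOn.inv₀ (by fun_prop) fun w hw => ?_
  exact (add_pos_of_nonneg_of_pos hw (inv_pos.2 hx)).ne'

lemma continuousOn_specPsi (hP : IsSpectralLaw P δ) : ContinuousOn (specPsi P δ) (Set.Ici 0) :=
  (continuousOn_const.div hP.continuousOn_specF fun _ hw => (hP.specF_pos hw).ne').sub
    continuousOn_id

lemma continuousOn_specMu (hP : IsSpectralLaw P δ) : ContinuousOn (specMu P) (Set.Ici 0) := by
  have hcont : ContinuousOn (fun w => 1 - w * specF P w) (Set.Ici 0) :=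
    continuousOn_const.sub (continuousOn_id.mul hP.continuousOn_specF)
  exact hcont.congr fun w hw =>
    eq_sub_of_add_eq' (by linarith [hP.mul_specF hw])

lemma tendsto_mul_specMu (hP : IsSpectralLaw P δ) :
    Tendsto (fun w => w * specMu P w) atTop (𝓝 (∫ x, x⁻¹ ∂P)) := by
  have := hP.isProb
  obtain ⟨a, b, ha, hab⟩ := hP.support
  have hm (w : ℝ) : Measurable fun x : ℝ => (w⁻¹ + x)⁻¹ := by fun_prop
  have hlim : Tendsto (fun w : ℝ => ∫ x, (w⁻¹ + x)⁻¹ ∂P) atTop (𝓝 (∫ x, x⁻¹ ∂P)) := by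
    refine tendsto_integral_filter_of_dominated_convergence (fun _ => a⁻¹)
      (Eventually.of_forall fun w => (hm w).aestronglyMeasurable) ?_ (integrable_const _) ?_
    · filter_upwards [eventually_ge_atTop 0] with w hw
      filter_upwards [hab, hP.ae_pos] with x hx hx0
      rw [Real.norm_of_nonneg (by positivity)]
      exact inv_anti₀ ha (hx.1.trans (le_add_of_nonneg_left (by positivity)))
    · filter_upwards [hP.ae_pos] with x hx
      simpa using (tendsto_inv_atTop_zero.add_const x).inv₀ (by simpa using hx.ne')
  refine hlim.congr' ?_
  filter_upwards [eventually_gt_atTop 0] with w hw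
  rw [specMu, ← integral_const_mul]
  congr 1 with x
  rw [show w⁻¹ + x = w⁻¹ * (1 + x * w) by field_simp, mul_inv, inv_inv]

lemma tendsto_specMu (hP : IsSpectralLaw P δ) : Tendsto (specMu P) atTop (𝓝 0) := by
  have hlim := hP.tendsto_mul_specMu.mul tendsto_inv_atTop_zero
  rw [mul_zero] at hlim
  refine hlim.congr' ?_
  filter_upwards [eventually_gt_atTop 0] with w hw
  field_simp

lemma integral_inv_pos (hP : IsSpectralLaw P δ) : 0 < ∫ x, x⁻¹ ∂P := by
  have := hP.isProb
  obtain ⟨a, b, ha, hab⟩ := hP.support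
  have hint : Integrable (fun x : ℝ => x⁻¹) P := by
    refine Integrable.of_bound measurable_inv.aestronglyMeasurable a⁻¹ ?_
    filter_upwards [hab, hP.ae_pos] with x hx hx0
    rw [Real.norm_of_nonneg (by positivity)]
    exact inv_anti₀ ha hx.1
  have hnonneg : 0 ≤ᵐ[P] fun x : ℝ => x⁻¹ := hP.ae_pos.mono fun x hx => (inv_pos.2 hx).le
  refine (integral_nonneg_of_ae hnonneg).lt_of_ne' fun hzero => ?_
  obtain ⟨x, hx, hx0⟩ :=
    (((integral_eq_zero_iff_of_nonneg_ae hnonneg hint).1 hzero).and hP.ae_pos).exists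
  exact (inv_pos.2 hx0).ne' hx

lemma mse_inv (hP : IsSpectralLaw P δ) (hw : 0 ≤ w) :
    mse P (ENNReal.ofReal w)⁻¹ = specMu P w := by
  refine integral_congr_ae ?_
  filter_upwards [hP.ae_pos] with x hx
  rw [div_eq_mul_inv, inv_inv, ← ENNReal.ofReal_mul hx.le, ← ENNReal.ofReal_one,
    ← ENNReal.ofReal_add zero_le_one (by positivity),
    ← ENNReal.ofReal_inv_of_pos (by positivity), ENNReal.toReal_ofReal (by positivity)]

lemma mse_zero (hP : IsSpectralLaw P δ) : mse P 0 = 0 := by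
  refine integral_eq_zero_of_ae ?_
  filter_upwards [hP.ae_pos] with x hx
  simp [ENNReal.div_zero, hx]

lemma PhiMap_inv (hP : IsSpectralLaw P δ) (hw : 0 ≤ w) :
    PhiMap P δ (ENNReal.ofReal w)⁻¹ = (specPsi P δ w)⁻¹ := by
  have hδ := hP.pos
  have hF := hP.specF_pos hw
  have hΨ : 0 < specPsi P δ w := zero_lt_one.trans_le (hP.one_le_specPsi hw)
  have hlintegral : ∫⁻ x, (ENNReal.ofReal w + (ENNReal.ofReal x)⁻¹)⁻¹ ∂P =
      ENNReal.ofReal (specF P w) := by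
    rw [specF, ofReal_integral_eq_lintegral_ofReal (hP.integrable_specF hw)]
    · refine lintegral_congr_ae ?_
      filter_upwards [hP.ae_pos] with x hx
      rw [← ENNReal.ofReal_inv_of_pos hx, ← ENNReal.ofReal_add hw (by positivity),
        ← ENNReal.ofReal_inv_of_pos (by positivity)]
    · filter_upwards [hP.ae_pos] with x hx
      positivity
  rw [PhiMap, inv_inv, hlintegral, ← ENNReal.ofReal_inv_of_pos hδ,
    ← ENNReal.ofReal_mul (by positivity), ← ENNReal.ofReal_inv_of_pos (by positivity),
    ← ENNReal.ofReal_sub _ hw, mul_inv, inv_inv, ← div_eq_mul_inv, ← specPsi,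
    ← ENNReal.ofReal_inv_of_pos hΨ, ENNReal.toReal_ofReal (by positivity)]

end IsSpectralLaw

end Spectral

section Dynamics

/-- The extrinsic precision `1 / φ(v, s)`. -/
noncomputable def prec (f : ℝ → ℝ) (s v : ℝ) : ℝ := (mmseZNoisy f s v)⁻¹ - v⁻¹

variable {f : ℝ → ℝ} {P : Measure ℝ} {δ s v v' : ℝ}

lemma mmseZNoisy_pos (hf : Measurable f) (hs : 0 < s) (hv : 0 < v) (hv1 : v ≤ 1) :
    0 < mmseZNoisy f s v :=
  lt_of_lt_of_le (by positivity) (mul_div_add_le_mmseZNoisy hf hs.le hv hv1)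

lemma prec_nonneg (hf : Measurable f) (hs : 0 < s) (hv : 0 < v) (hv1 : v ≤ 1) :
    0 ≤ prec f s v :=
  sub_nonneg.2 (inv_anti₀ (mmseZNoisy_pos hf hs hv hv1) (mmseZNoisy_le_self hf hs.le hv hv1))

lemma prec_le (hf : Measurable f) (hs : 0 < s) (hv : 0 < v) (hv1 : v ≤ 1) :
    prec f s v ≤ s⁻¹ := by
  rw [prec, sub_le_iff_le_add]
  calc (mmseZNoisy f s v)⁻¹ ≤ (v * (s / (v + s)))⁻¹ :=
        inv_anti₀ (by positivity) (mul_div_add_le_mmseZNoisy hf hs.le hv hv1)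
    _ = s⁻¹ + v⁻¹ := by field_simp

lemma prec_anti (hf : Measurable f) (hs : 0 < s) (hv' : 0 < v') (hvv' : v' ≤ v) (hv1 : v ≤ 1) :
    prec f s v ≤ prec f s v' := by
  rcases hvv'.eq_or_lt with rfl | hlt
  · exact le_rfl
  have hm := mmseZNoisy_pos hf hs (hv'.trans hlt) hv1
  have hm' := mmseZNoisy_pos hf hs hv' (hlt.le.trans hv1)
  have hsum : (mmseZNoisy f s v)⁻¹ + (v'⁻¹ - v⁻¹) ≤ (mmseZNoisy f s v')⁻¹ := by
    rw [← one_div (mmseZNoisy f s v'), le_div_iff₀ hm', ← mul_le_mul_iff_right₀ hm, mul_one]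
    calc mmseZNoisy f s v * (((mmseZNoisy f s v)⁻¹ + (v'⁻¹ - v⁻¹)) * mmseZNoisy f s v')
        = mmseZNoisy f s v' * (1 + (v'⁻¹ - v⁻¹) * mmseZNoisy f s v) := by
          rw [← mul_assoc, mul_add, mul_inv_cancel₀ hm.ne']
          ring
      _ ≤ mmseZNoisy f s v := mmseZNoisy_mul_le hf s hv' hlt hv1
  rw [prec, prec]
  linarith

lemma phiNoisy_eq (hf : Measurable f) (hs : 0 < s) (hv : 0 < v) (hv1 : v ≤ 1) :
    phiNoisy f s v = (ENNReal.ofReal (prec f s v))⁻¹ :=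
  extrinsic_eq (mmseZNoisy_pos hf hs hv hv1) hv

lemma mmseZNoisy_div_self (hv : v ≠ 0) :
    mmseZNoisy f s v / v = (1 + v * prec f s v)⁻¹ := by
  rw [prec, mul_sub, mul_inv_cancel₀ hv, add_sub_cancel, mul_inv, inv_inv, inv_mul_eq_div]

/-- The limit of the extrinsic precisions along the noisy state evolution; they are increasing, so
it is their supremum. -/
noncomputable def limitPrec (f : ℝ → ℝ) (P : Measure ℝ) (δ s : ℝ) : ℝ :=
  ⨆ t, prec f s (VrNoisy f P δ s t)

/-- The limit of `V_r^t` in the noisy state evolution. -/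
noncomputable def limitVr (f : ℝ → ℝ) (P : Measure ℝ) (δ s : ℝ) : ℝ :=
  (specPsi P δ (limitPrec f P δ s))⁻¹

namespace IsSpectralLaw

lemma VrNoisy_mem (hP : IsSpectralLaw P δ) (hf : Measurable f) (hs : 0 < s) (t : ℕ) :
    VrNoisy f P δ s t ∈ Set.Ioc 0 1 := by
  induction t with
  | zero => simp [VrNoisy]
  | succ t ih =>
    have hw := prec_nonneg hf hs ih.1 ih.2
    have hΨ := hP.one_le_specPsi hw
    rw [VrNoisy, phiNoisy_eq hf hs ih.1 ih.2, hP.PhiMap_inv hw]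
    exact ⟨by positivity, inv_le_one_of_one_le₀ hΨ⟩

lemma prec_VrNoisy_nonneg (hP : IsSpectralLaw P δ) (hf : Measurable f) (hs : 0 < s) (t : ℕ) :
    0 ≤ prec f s (VrNoisy f P δ s t) :=
  prec_nonneg hf hs (hP.VrNoisy_mem hf hs t).1 (hP.VrNoisy_mem hf hs t).2

lemma VrNoisy_succ (hP : IsSpectralLaw P δ) (hf : Measurable f) (hs : 0 < s) (t : ℕ) :
    VrNoisy f P δ s (t + 1) = (specPsi P δ (prec f s (VrNoisy f P δ s t)))⁻¹ := by
  obtain ⟨hpos, hle⟩ := hP.VrNoisy_mem hf hs t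
  rw [VrNoisy, phiNoisy_eq hf hs hpos hle, hP.PhiMap_inv (prec_nonneg hf hs hpos hle)]

lemma VrNoisy_antitone (hP : IsSpectralLaw P δ) (hf : Measurable f) (hs : 0 < s) :
    Antitone (VrNoisy f P δ s) := by
  refine antitone_nat_of_succ_le fun t => ?_
  induction t with
  | zero => exact (hP.VrNoisy_mem hf hs 1).2
  | succ t ih =>
    have hw := hP.prec_VrNoisy_nonneg hf hs t
    have hprec := prec_anti hf hs (hP.VrNoisy_mem hf hs (t + 1)).1 ih (hP.VrNoisy_mem hf hs t).2
    rw [hP.VrNoisy_succ hf hs (t + 1)]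
    nth_rw 2 [hP.VrNoisy_succ hf hs t]
    exact inv_anti₀ (zero_lt_one.trans_le (hP.one_le_specPsi hw)) (hP.specPsi_mono hw hprec)

lemma tendsto_prec (hP : IsSpectralLaw P δ) (hf : Measurable f) (hs : 0 < s) :
    Tendsto (fun t => prec f s (VrNoisy f P δ s t)) atTop (𝓝 (limitPrec f P δ s)) := by
  have hmem := hP.VrNoisy_mem hf hs
  refine tendsto_atTop_ciSup (fun i j hij =>
    prec_anti hf hs (hmem j).1 (hP.VrNoisy_antitone hf hs hij) (hmem i).2) ⟨s⁻¹, ?_⟩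
  rintro _ ⟨t, rfl⟩
  exact prec_le hf hs (hmem t).1 (hmem t).2

lemma limitPrec_nonneg (hP : IsSpectralLaw P δ) (hf : Measurable f) (hs : 0 < s) :
    0 ≤ limitPrec f P δ s :=
  ge_of_tendsto' (hP.tendsto_prec hf hs) (hP.prec_VrNoisy_nonneg hf hs)

lemma limitVr_mem (hP : IsSpectralLaw P δ) (hf : Measurable f) (hs : 0 < s) :
    limitVr f P δ s ∈ Set.Ioc 0 1 :=
  have hΨ := hP.one_le_specPsi (hP.limitPrec_nonneg hf hs)
  ⟨inv_pos.2 (zero_lt_one.trans_le hΨ), inv_le_one_of_one_le₀ hΨ⟩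

lemma tendsto_comp_prec (hP : IsSpectralLaw P δ) (hf : Measurable f) (hs : 0 < s) {g : ℝ → ℝ}
    (hg : ContinuousOn g (Set.Ici 0)) :
    Tendsto (fun t => g (prec f s (VrNoisy f P δ s t))) atTop (𝓝 (g (limitPrec f P δ s))) :=
  (hg _ (hP.limitPrec_nonneg hf hs)).tendsto.comp (tendsto_nhdsWithin_iff.2
    ⟨hP.tendsto_prec hf hs, Eventually.of_forall (hP.prec_VrNoisy_nonneg hf hs)⟩)

lemma tendsto_VrNoisy (hP : IsSpectralLaw P δ) (hf : Measurable f) (hs : 0 < s) :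
    Tendsto (VrNoisy f P δ s) atTop (𝓝 (limitVr f P δ s)) := by
  rw [← tendsto_add_atTop_iff_nat 1]
  simp_rw [hP.VrNoisy_succ hf hs]
  exact (hP.tendsto_comp_prec hf hs hP.continuousOn_specPsi).inv₀
    (inv_pos.1 (hP.limitVr_mem hf hs).1).ne'

lemma tendsto_VrNoisy_prodMk (hP : IsSpectralLaw P δ) (hf : Measurable f) (hs : 0 < s) :
    Tendsto (fun t => (VrNoisy f P δ s t, s)) atTop
      (𝓝[variancePairs] (limitVr f P δ s, s)) := by
  refine tendsto_nhdsWithin_iff.2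
    ⟨(hP.tendsto_VrNoisy hf hs).prodMk_nhds tendsto_const_nhds, Eventually.of_forall fun t => ?_⟩
  exact ⟨(hP.VrNoisy_mem hf hs t).1, (hP.VrNoisy_mem hf hs t).2, hs.le⟩

lemma tendsto_mse (hP : IsSpectralLaw P δ) (hf : Measurable f) (hs : 0 < s) :
    Tendsto (fun t => mse P (VlNoisy f P δ s t)) atTop (𝓝 (specMu P (limitPrec f P δ s))) := by
  refine (hP.tendsto_comp_prec hf hs hP.continuousOn_specMu).congr fun t => ?_
  obtain ⟨hpos, hle⟩ := hP.VrNoisy_mem hf hs t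
  rw [VlNoisy, phiNoisy_eq hf hs hpos hle, hP.mse_inv (prec_nonneg hf hs hpos hle)]

lemma mseStarNoisy_eq (hP : IsSpectralLaw P δ) (hf : Measurable f) (hs : 0 < s) :
    mseStarNoisy f P δ s = specMu P (limitPrec f P δ s) :=
  (hP.tendsto_mse hf hs).limUnder_eq

lemma limitVr_mul_limitPrec (hP : IsSpectralLaw P δ) (hf : Measurable f) (hs : 0 < s) :
    limitVr f P δ s * limitPrec f P δ s =
      (1 - mseStarNoisy f P δ s) / (δ - 1 + mseStarNoisy f P δ s) := by
  rw [limitVr, hP.specPsi_inv_mul (hP.limitPrec_nonneg hf hs), hP.mseStarNoisy_eq hf hs]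

lemma mseStarNoisy_mem (hP : IsSpectralLaw P δ) (hf : Measurable f) (hs : 0 < s) :
    mseStarNoisy f P δ s ∈ Set.Icc 0 1 := by
  rw [hP.mseStarNoisy_eq hf hs]
  exact ⟨hP.specMu_nonneg (hP.limitPrec_nonneg hf hs), hP.specMu_le_one (hP.limitPrec_nonneg hf hs)⟩

lemma tendsto_mmseZNoisy_div_VrNoisy (hP : IsSpectralLaw P δ) (hf : Measurable f) (hs : 0 < s) :
    Tendsto (fun t => mmseZNoisy f s (VrNoisy f P δ s t) / VrNoisy f P δ s t) atTop
      (𝓝 ((δ - 1 + mseStarNoisy f P δ s) / δ)) := by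
  have hpos : 0 < δ - 1 + mseStarNoisy f P δ s := by
    linarith [hP.one_lt, (hP.mseStarNoisy_mem hf hs).1]
  have hlimit : (δ - 1 + mseStarNoisy f P δ s) / δ =
      (1 + limitVr f P δ s * limitPrec f P δ s)⁻¹ := by
    rw [hP.limitVr_mul_limitPrec hf hs, eq_comm, inv_eq_iff_eq_inv, inv_div]
    field_simp
    ring
  simp_rw [mmseZNoisy_div_self (hP.VrNoisy_mem hf hs _).1.ne']
  rw [hlimit]
  have hV := (hP.limitVr_mem hf hs).1
  have hW := hP.limitPrec_nonneg hf hs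
  exact (((hP.tendsto_VrNoisy hf hs).mul (hP.tendsto_prec hf hs)).const_add 1).inv₀ (by positivity)

end IsSpectralLaw

end Dynamics

section Threshold

variable {f : ℝ → ℝ} {P : Measure ℝ} {δ δ' m v v' w ε : ℝ}

lemma extrinsic_zero (hv : 0 < v) : extrinsic 0 v = 0 := by
  simp [extrinsic, hv]

lemma eq_zero_of_extrinsic_eq_zero (hm : 0 ≤ m) (h : extrinsic m v = 0) : m = 0 := by
  rw [extrinsic, ENNReal.inv_eq_zero, ENNReal.sub_eq_top_iff, ENNReal.inv_eq_top,
    ENNReal.ofReal_eq_zero] at h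
  exact h.1.antisymm hm

lemma extrinsic_le (hw : 0 ≤ w) (hv : 0 < v) (h : m ≤ (w + v⁻¹)⁻¹) :
    extrinsic m v ≤ (ENNReal.ofReal w)⁻¹ := by
  have hv' : (ENNReal.ofReal v)⁻¹ ≠ ∞ := by simpa using hv
  refine ENNReal.inv_le_inv.2 (ENNReal.le_sub_of_add_le_right hv' ?_)
  rw [← ENNReal.ofReal_inv_of_pos hv, ← ENNReal.ofReal_add hw (by positivity),
    ENNReal.le_inv_iff_le_inv, ← ENNReal.ofReal_inv_of_pos (by positivity)]
  exact ENNReal.ofReal_le_ofReal h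

lemma mmseZ_le_self (hf : Measurable f) (hv : 0 < v) (hv1 : v ≤ 1) : mmseZ f v ≤ v := by
  rw [← mmseZNoisy_zero hf hv hv1]
  exact mmseZNoisy_le_self hf le_rfl hv hv1

lemma mmseZ_eq_zero_of_le (hf : Measurable f) (hv' : 0 < v') (hvv' : v' ≤ v) (hv1 : v ≤ 1)
    (h : mmseZ f v = 0) : mmseZ f v' = 0 := by
  rcases hvv'.eq_or_lt with rfl | hlt
  · exact h
  have hle := mmseZNoisy_mul_le hf 0 hv' hlt hv1
  rw [mmseZNoisy_zero hf hv' (hvv'.trans hv1), mmseZNoisy_zero hf (hv'.trans hlt) hv1, h,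
    mul_zero, add_zero, mul_one] at hle
  exact hle.antisymm mmseGiven_nonneg

lemma VrStar_mem (f : ℝ → ℝ) (P : Measure ℝ) (δ : ℝ) : VrStar f P δ ∈ Set.Icc 0 1 := by
  rw [VrStar]
  split_ifs with hne
  · obtain ⟨w, hw⟩ := hne
    have hlb : ∀ u ∈ positiveSet f P δ, 0 ≤ u := fun u hu => hu.1.1.le
    exact ⟨Real.sInf_nonneg hlb, (csInf_le ⟨0, hlb⟩ hw).trans hw.1.2⟩
  · exact ⟨zero_le_one, le_rfl⟩

lemma Pfun_pos_of_VrStar_lt (hlt : VrStar f P δ < v) (hv1 : v ≤ 1) : 0 < Pfun f P δ v := by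
  rw [VrStar] at hlt
  split_ifs at hlt with hne
  · obtain ⟨w, hw, hwv⟩ := exists_lt_of_csInf_lt hne hlt
    exact hw.2 v ⟨hwv.le, hv1⟩
  · exact absurd hv1 hlt.not_ge

namespace IsSpectralLaw

lemma Pfun_pos_of_mmseZ_eq_zero (hP : IsSpectralLaw P δ) (hδ' : 1 < δ') (hv : 0 < v)
    (h : mmseZ f v = 0) : 0 < Pfun f P δ' v := by
  rw [Pfun, phi, h, extrinsic_zero hv, hP.mse_zero, zero_div]
  linarith

-- `MSE* = 0` means `φ(V_r*) = 0`: either `V_r* = 0`, or `mmse_z` vanishes on `(0, V_r*]`.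
lemma Pfun_pos_of_mseStar_eq_zero (hP : IsSpectralLaw P δ) (hf : Measurable f) (hδ' : 1 < δ')
    (h : mseStar f P δ' = 0) (hv : 0 < v) (hv1 : v ≤ 1) : 0 < Pfun f P δ' v := by
  have := hP.isProb
  rcases lt_or_ge (VrStar f P δ') v with hlt | hge
  · exact Pfun_pos_of_VrStar_lt hlt hv1
  have hphi : phiExt f (VrStar f P δ') = 0 := eq_zero_of_mse_eq_zero h
  rw [phiExt, if_neg (hv.trans_le hge).ne'] at hphi
  have hmmse := eq_zero_of_extrinsic_eq_zero mmseGiven_nonneg hphi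
  exact hP.Pfun_pos_of_mmseZ_eq_zero hδ' hv
    (mmseZ_eq_zero_of_le hf hv hge (VrStar_mem f P δ').2 hmmse)

lemma exists_Pfun_pos_of_perfectThreshold_lt (hP : IsSpectralLaw P δ) (hf : Measurable f)
    (h : perfectThreshold f P < (δ : EReal)) :
    ∃ δ', 1 < δ' ∧ δ' < δ ∧ ∀ v, 0 < v → v ≤ 1 → 0 < Pfun f P δ' v := by
  obtain ⟨_, ⟨δ', ⟨hδ', hzero⟩, rfl⟩, hlt⟩ := sInf_lt_iff.1 h
  exact ⟨δ', hδ', EReal.coe_lt_coe_iff.1 hlt, fun v hv hv1 =>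
    hP.Pfun_pos_of_mseStar_eq_zero hf hδ' hzero hv hv1⟩

end IsSpectralLaw

lemma Pieces.tendsto_mmseZ_div_self (D : Pieces f) :
    Tendsto (fun v => mmseZ f v / v) (𝓝[>] 0) (𝓝 (1 - D.p)) := by
  have hunit : Set.Ioc (0 : ℝ) 1 ∈ 𝓝[>] 0 := Ioc_mem_nhdsGT zero_lt_one
  have hmap : Tendsto (fun v : ℝ => (v, (0 : ℝ))) (𝓝[>] 0) (𝓝[variancePairs] (0, 0)) := by
    refine tendsto_nhdsWithin_iff.2 ⟨?_, ?_⟩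
    · exact (tendsto_nhdsWithin_of_tendsto_nhds tendsto_id).prodMk_nhds tendsto_const_nhds
    · filter_upwards [hunit] with v hv using ⟨hv.1, hv.2, le_rfl⟩
  have hlim := (D.tendsto_mmseZNoisy_div_self.comp hmap).add_const (1 - D.p)
  rw [zero_add] at hlim
  refine hlim.congr' ?_
  filter_upwards [hunit] with v hv
  simp only [Function.comp_apply, add_zero, div_self hv.1.ne', mul_one, sub_add_cancel,
    mmseZNoisy_zero D.measurable hv.1 hv.2]

namespace IsSpectralLaw

lemma tendsto_mse_phi (hP : IsSpectralLaw P δ) (D : Pieces f) (hp : 0 < D.p) :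
    Tendsto (fun v => mse P (phi f v)) (𝓝[>] 0) (𝓝 0) := by
  have := hP.isProb
  have hprec : Tendsto (fun v : ℝ => D.p / 2 * v⁻¹) (𝓝[>] 0) atTop :=
    tendsto_inv_nhdsGT_zero.const_mul_atTop (by positivity)
  have hlt : 1 - D.p < (D.p / 2 + 1)⁻¹ := by
    rw [← one_div, lt_div_iff₀ (by positivity)]
    nlinarith
  refine squeeze_zero' (Eventually.of_forall fun v => mse_nonneg P _) ?_
    (hP.tendsto_specMu.comp hprec)
  filter_upwards [D.tendsto_mmseZ_div_self.eventually_lt_const hlt, self_mem_nhdsWithin]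
    with v hq (hv : 0 < v)
  have hw : 0 ≤ D.p / 2 * v⁻¹ := by positivity
  rw [Function.comp_apply, ← hP.mse_inv hw]
  refine mse_mono P (extrinsic_le hw hv ?_)
  calc mmseZ f v ≤ (D.p / 2 + 1)⁻¹ * v := ((div_lt_iff₀ hv).1 hq).le
    _ = (D.p / 2 * v⁻¹ + v⁻¹)⁻¹ := by field_simp

lemma tendsto_Pfun (hP : IsSpectralLaw P δ) (D : Pieces f) (hp : 0 < D.p) (δ' : ℝ) :
    Tendsto (Pfun f P δ') (𝓝[>] 0) (𝓝 (D.p * δ' - 1)) := by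
  have hlim := (hP.tendsto_mse_phi D hp).sub
    (((D.tendsto_mmseZ_div_self.const_sub 1).const_mul δ').const_sub 1)
  rwa [show 0 - (1 - δ' * (1 - (1 - D.p))) = D.p * δ' - 1 by ring] at hlim

lemma one_lt_p_mul (hP : IsSpectralLaw P δ) (D : Pieces f) (hp : 0 < D.p) (hδ' : δ' < δ)
    (hpos : ∀ v, 0 < v → v ≤ 1 → 0 < Pfun f P δ' v) : 1 < D.p * δ := by
  have hnonneg : 0 ≤ D.p * δ' - 1 := by
    refine ge_of_tendsto (hP.tendsto_Pfun D hp δ') ?_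
    filter_upwards [Ioc_mem_nhdsGT (zero_lt_one' ℝ)] with v hv using (hpos v hv.1 hv.2).le
  linarith [mul_lt_mul_of_pos_left hδ' hp]

lemma Pfun_eq (hP : IsSpectralLaw P δ) (hv : 0 < v) (hm : 0 < mmseZ f v) (hmv : mmseZ f v ≤ v) :
    Pfun f P δ' v =
      ((mmseZ f v)⁻¹ - v⁻¹) * (δ' * mmseZ f v - specF P ((mmseZ f v)⁻¹ - v⁻¹)) := by
  have hw : 0 ≤ (mmseZ f v)⁻¹ - v⁻¹ := sub_nonneg.2 (inv_anti₀ hm hmv)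
  rw [Pfun, phi, extrinsic_eq hm hv, hP.mse_inv hw, mul_sub _ _ (specF _ _), hP.mul_specF hw]
  field_simp
  ring

lemma inv_lt_specPsi_of_Pfun_pos (hP : IsSpectralLaw P δ) (hδ' : δ' ≤ δ) (hv : 0 < v)
    (hm : 0 < mmseZ f v) (hmv : mmseZ f v ≤ v) (hpos : 0 < Pfun f P δ' v) :
    0 < (mmseZ f v)⁻¹ - v⁻¹ ∧ v⁻¹ < specPsi P δ ((mmseZ f v)⁻¹ - v⁻¹) := by
  rw [hP.Pfun_eq hv hm hmv] at hpos
  have hw : 0 ≤ (mmseZ f v)⁻¹ - v⁻¹ := sub_nonneg.2 (inv_anti₀ hm hmv)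
  have hF := hP.specF_pos hw
  have hgap := pos_of_mul_pos_right hpos hw
  refine ⟨pos_of_mul_pos_left hpos hgap.le, ?_⟩
  have hlt : (mmseZ f v)⁻¹ < δ / specF P ((mmseZ f v)⁻¹ - v⁻¹) := by
    rw [lt_div_iff₀ hF, inv_mul_lt_iff₀ hm, mul_comm]
    linarith [mul_le_mul_of_nonneg_right hδ' hm.le]
  rw [specPsi]
  linarith

lemma exists_precision_gap (hP : IsSpectralLaw P δ) (hf : Measurable f) (hδ' : δ' ≤ δ) (hv : 0 < v)
    (hv1 : v ≤ 1) (hpos : 0 < Pfun f P δ' v) :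
    ∃ w, 0 ≤ w ∧ v⁻¹ < specPsi P δ w ∧ mmseZ f v < (w + v⁻¹)⁻¹ := by
  have hδ : 0 < δ - 1 := sub_pos.2 hP.one_lt
  have hm0 : 0 ≤ mmseZ f v := mmseGiven_nonneg
  rcases hm0.eq_or_lt with hzero | hm
  · have hw : 0 ≤ (v⁻¹ + 1) / (δ - 1) := by positivity
    have hΨ := hP.le_specPsi hw
    rw [mul_div_cancel₀ _ hδ.ne'] at hΨ
    exact ⟨_, hw, by linarith, by rw [← hzero]; positivity⟩
  · obtain ⟨hw₀, hΨ⟩ :=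
      hP.inv_lt_specPsi_of_Pfun_pos hδ' hv hm (mmseZ_le_self hf hv hv1) hpos
    have hcont := (hP.continuousOn_specPsi.continuousAt (Ici_mem_nhds hw₀)).mono_left
      (nhdsWithin_le_nhds (s := Set.Iio ((mmseZ f v)⁻¹ - v⁻¹)))
    obtain ⟨w, hΨw, hw, hww₀⟩ :=
      ((hcont.eventually (lt_mem_nhds hΨ)).and (Ioo_mem_nhdsLT hw₀)).exists
    refine ⟨w, hw.le, hΨw, ?_⟩
    rw [lt_inv_comm₀ hm (by positivity)]
    linarith

end IsSpectralLaw

lemma Pieces.eventually_le_prec (D : Pieces f) (hw : 0 ≤ w) (hv : 0 < v) (hv1 : v ≤ 1)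
    (h : mmseZ f v < (w + v⁻¹)⁻¹) :
    ∀ᶠ x in 𝓝[variancePairs] (v, 0), 0 < x.2 → w ≤ prec f x.2 x.1 := by
  obtain ⟨c, hc, hcw⟩ := exists_between h
  have hcont : ContinuousAt (fun x : ℝ × ℝ => (w + x.1⁻¹)⁻¹) (v, 0) :=
    (continuousAt_const.add (continuousAt_fst.inv₀ hv.ne')).inv₀
      (show w + v⁻¹ ≠ 0 by positivity)
  filter_upwards [D.eventually_mmseZNoisy_lt hv hv1 hc, self_mem_nhdsWithin,
    nhdsWithin_le_nhds (hcont.eventually_const_lt hcw)] with x hmc ⟨hx, hx1, _⟩ hcx hs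
  have hlt := (lt_inv_comm₀ (mmseZNoisy_pos D.measurable hs hx hx1) (by positivity)).1
    (hmc.trans hcx)
  rw [prec]
  linarith

namespace IsSpectralLaw

-- Near `(v, 0)` the state evolution moves strictly below `v`, so `v` cannot be its limit.
lemma eventually_limitVr_ne (hP : IsSpectralLaw P δ) (D : Pieces f) (hδ' : δ' ≤ δ) (hv : 0 < v)
    (hv1 : v ≤ 1) (hpos : 0 < Pfun f P δ' v) :
    ∀ᶠ x : ℝ × ℝ in 𝓝 (v, 0), 0 < x.2 → limitVr f P δ x.2 ≠ x.1 := by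
  have hf := D.measurable
  obtain ⟨w, hw, hΨ, hmw⟩ := hP.exists_precision_gap hf hδ' hv hv1 hpos
  have hinv : ∀ᶠ x : ℝ × ℝ in 𝓝 (v, 0), x.1⁻¹ < specPsi P δ w := by
    have hcont : ContinuousAt (fun x : ℝ × ℝ => x.1⁻¹) (v, 0) := continuousAt_fst.inv₀ hv.ne'
    exact hcont.eventually_lt_const hΨ
  have hprec := eventually_nhdsWithin_iff.1
    (eventually_eventually_nhdsWithin.2 (D.eventually_le_prec hw hv hv1 hmw))
  filter_upwards [hprec, hinv] with ⟨u, s⟩ hle hlt hs hu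
  dsimp only at hle hlt hs hu
  subst hu
  have hmem := hP.limitVr_mem hf hs
  have hwW : w ≤ limitPrec f P δ s := by
    refine ge_of_tendsto (hP.tendsto_prec hf hs) ?_
    exact ((hP.tendsto_VrNoisy_prodMk hf hs).eventually (hle ⟨hmem.1, hmem.2, hs.le⟩)).mono
      fun t ht => ht hs
  rw [limitVr, inv_inv] at hlt
  exact absurd (hP.specPsi_mono hw hwW) hlt.not_ge

lemma eventually_limitVr_lt (hP : IsSpectralLaw P δ) (D : Pieces f) (hδ' : δ' ≤ δ)
    (hpos : ∀ v, 0 < v → v ≤ 1 → 0 < Pfun f P δ' v) (hε : 0 < ε) :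
    ∀ᶠ s in 𝓝[>] (0 : ℝ), limitVr f P δ s < ε := by
  have hne : ∀ᶠ s in 𝓝 (0 : ℝ), ∀ v ∈ Set.Icc ε 1, 0 < s → limitVr f P δ s ≠ v := by
    refine isCompact_Icc.eventually_forall_of_forall_eventually fun v hv => ?_
    have hv0 := hε.trans_le hv.1
    have hswap : Tendsto Prod.swap (𝓝 ((0 : ℝ), v)) (𝓝 (v, 0)) := continuous_swap.tendsto _
    exact hswap.eventually
      (hP.eventually_limitVr_ne D hδ' hv0 hv.2 (hpos v hv0 hv.2))
  filter_upwards [nhdsWithin_le_nhds hne, self_mem_nhdsWithin] with s hs hs0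
  by_contra! hge
  exact hs _ ⟨hge, (hP.limitVr_mem D.measurable hs0).2⟩ hs0 rfl

lemma tendsto_limitVr (hP : IsSpectralLaw P δ) (D : Pieces f) (hδ' : δ' ≤ δ)
    (hpos : ∀ v, 0 < v → v ≤ 1 → 0 < Pfun f P δ' v) :
    Tendsto (limitVr f P δ) (𝓝[>] 0) (𝓝 0) := by
  refine tendsto_order.2 ⟨fun c hc => ?_, fun ε hε => hP.eventually_limitVr_lt D hδ' hpos hε⟩
  filter_upwards [self_mem_nhdsWithin] with s hs
  exact hc.trans (hP.limitVr_mem D.measurable hs).1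

end IsSpectralLaw

end Threshold

section Asymptotics

variable {f : ℝ → ℝ} {P : Measure ℝ} {δ : ℝ}

namespace IsSpectralLaw

lemma tendsto_limitPrec (hP : IsSpectralLaw P δ) (hf : Measurable f)
    (hV : Tendsto (limitVr f P δ) (𝓝[>] 0) (𝓝 0)) :
    Tendsto (limitPrec f P δ) (𝓝[>] 0) atTop := by
  obtain ⟨B, hB⟩ := hP.exists_specPsi_le
  have hVpos : ∀ᶠ s in 𝓝[>] 0, limitVr f P δ s ∈ Set.Ioi 0 :=
    eventually_mem_nhdsWithin.mono fun s hs => (hP.limitVr_mem hf hs).1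
  have hΨ : Tendsto (fun s => (limitVr f P δ s)⁻¹) (𝓝[>] 0) atTop :=
    tendsto_inv_nhdsGT_zero.comp (tendsto_nhdsWithin_iff.2 ⟨hV, hVpos⟩)
  refine (tendsto_const_mul_atTop_of_pos (sub_pos.2 hP.one_lt)).1
    (tendsto_atTop_mono' _ ?_ (tendsto_atTop_add_const_right _ (-B) hΨ))
  filter_upwards [self_mem_nhdsWithin] with s hs
  rw [limitVr, inv_inv]
  linarith [hB _ (hP.limitPrec_nonneg hf hs)]

lemma tendsto_mseStarNoisy (hP : IsSpectralLaw P δ) (hf : Measurable f)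
    (hV : Tendsto (limitVr f P δ) (𝓝[>] 0) (𝓝 0)) :
    Tendsto (mseStarNoisy f P δ) (𝓝[>] 0) (𝓝 0) := by
  refine (hP.tendsto_specMu.comp (hP.tendsto_limitPrec hf hV)).congr' ?_
  filter_upwards [self_mem_nhdsWithin] with s hs using (hP.mseStarNoisy_eq hf hs).symm

lemma tendsto_limitVr_mul_limitPrec (hP : IsSpectralLaw P δ) (hf : Measurable f)
    (hV : Tendsto (limitVr f P δ) (𝓝[>] 0) (𝓝 0)) :
    Tendsto (fun s => limitVr f P δ s * limitPrec f P δ s) (𝓝[>] 0) (𝓝 (δ - 1)⁻¹) := by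
  have hμ := hP.tendsto_mseStarNoisy hf hV
  have hδ : δ - 1 + 0 ≠ 0 := by linarith [hP.one_lt]
  have hlim := (hμ.const_sub 1).div (hμ.const_add (δ - 1)) hδ
  rw [sub_zero, add_zero, one_div] at hlim
  refine hlim.congr' ?_
  filter_upwards [self_mem_nhdsWithin] with s hs using (hP.limitVr_mul_limitPrec hf hs).symm

-- A joint limit at `(0, 0)` controls the iterated limit, first `t → ∞`, then `s → 0`.
lemma tendsto_mseStarNoisy_sub (hP : IsSpectralLaw P δ) (D : Pieces f)
    (hV : Tendsto (limitVr f P δ) (𝓝[>] 0) (𝓝 0)) :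
    Tendsto (fun s => (δ - 1 + mseStarNoisy f P δ s) / δ -
      (1 - D.p * (limitVr f P δ s / (limitVr f P δ s + s)))) (𝓝[>] 0) (𝓝 0) := by
  have hf := D.measurable
  have hmem : ∀ᶠ s in 𝓝[>] 0, (limitVr f P δ s, s) ∈ variancePairs := by
    filter_upwards [self_mem_nhdsWithin] with s (hs : 0 < s)
    exact ⟨(hP.limitVr_mem hf hs).1, (hP.limitVr_mem hf hs).2, hs.le⟩
  have hpair : Tendsto (fun s => (limitVr f P δ s, s)) (𝓝[>] 0) (𝓝[variancePairs] (0, 0)) :=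
    tendsto_nhdsWithin_iff.2
      ⟨hV.prodMk_nhds (tendsto_nhdsWithin_of_tendsto_nhds tendsto_id), hmem⟩
  refine Metric.nhds_basis_closedBall.tendsto_right_iff.2 fun η hη => ?_
  have hball := eventually_eventually_nhdsWithin.2
    (D.tendsto_mmseZNoisy_div_self.eventually (Metric.closedBall_mem_nhds 0 hη))
  filter_upwards [hpair.eventually hball, self_mem_nhdsWithin] with s hs (hs0 : 0 < s)
  have hVs := hP.tendsto_VrNoisy hf hs0
  have hne : limitVr f P δ s + s ≠ 0 := (add_pos (hP.limitVr_mem hf hs0).1 hs0).ne'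
  exact Metric.isClosed_closedBall.mem_of_tendsto
    ((hP.tendsto_mmseZNoisy_div_VrNoisy hf hs0).sub
      (((hVs.div (hVs.add_const s) hne).const_mul D.p).const_sub 1))
    ((hP.tendsto_VrNoisy_prodMk hf hs0).eventually hs)

lemma tendsto_div_limitVr (hP : IsSpectralLaw P δ) (D : Pieces f) (hp : 0 < D.p)
    (hV : Tendsto (limitVr f P δ) (𝓝[>] 0) (𝓝 0)) :
    Tendsto (fun s => s / limitVr f P δ s) (𝓝[>] 0) (𝓝 (D.p * δ - 1)) := by
  have hδ := hP.pos
  have hμ := hP.tendsto_mseStarNoisy D.measurable hV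
  have hfrac : Tendsto (fun s => limitVr f P δ s / (limitVr f P δ s + s)) (𝓝[>] 0)
      (𝓝 (D.p * δ)⁻¹) := by
    have hlim := (((hP.tendsto_mseStarNoisy_sub D hV).sub
      ((hμ.const_add (δ - 1)).div_const δ)).add_const 1).div_const D.p
    have hvalue : (0 - (δ - 1 + 0) / δ + 1) / D.p = (D.p * δ)⁻¹ := by
      field_simp
      ring
    rw [hvalue] at hlim
    refine hlim.congr fun s => ?_
    field_simp
    ring
  have hlim := (hfrac.inv₀ (by positivity)).sub_const 1
  rw [inv_inv] at hlim
  refine hlim.congr' ?_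
  filter_upwards [self_mem_nhdsWithin] with s hs
  rw [inv_div, add_div, div_self (hP.limitVr_mem D.measurable hs).1.ne', add_sub_cancel_left]

lemma tendsto_mseStarNoisy_div (hP : IsSpectralLaw P δ) (D : Pieces f) (hpδ : 1 < D.p * δ)
    (hV : Tendsto (limitVr f P δ) (𝓝[>] 0) (𝓝 0)) :
    Tendsto (fun s => mseStarNoisy f P δ s / s) (𝓝[>] 0)
      (𝓝 ((δ - 1) / (D.p * δ - 1) * ∫ x, x⁻¹ ∂P)) := by
  have hf := D.measurable
  have hp : 0 < D.p := pos_of_mul_pos_left (zero_lt_one.trans hpδ) hP.pos.le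
  have hδ1 : 0 < δ - 1 := sub_pos.2 hP.one_lt
  have hpδ1 : 0 < D.p * δ - 1 := sub_pos.2 hpδ
  have hW := hP.tendsto_limitPrec hf hV
  have hlim := (hP.tendsto_mul_specMu.comp hW).div
    ((hP.tendsto_div_limitVr D hp hV).mul (hP.tendsto_limitVr_mul_limitPrec hf hV))
    (by positivity)
  rw [show (∫ x, x⁻¹ ∂P) / ((D.p * δ - 1) * (δ - 1)⁻¹) =
    (δ - 1) / (D.p * δ - 1) * ∫ x, x⁻¹ ∂P by field_simp] at hlim
  refine hlim.congr' ?_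
  filter_upwards [self_mem_nhdsWithin, hW.eventually_gt_atTop 0] with s (hs : 0 < s) hWs
  have hVs := (hP.limitVr_mem hf hs).1
  simp only [Pi.div_apply, Function.comp_apply]
  rw [hP.mseStarNoisy_eq hf hs]
  field_simp

end IsSpectralLaw

lemma isEquivalent_mul_of_tendsto_div {g : ℝ → ℝ} {c : ℝ} (hc : c ≠ 0)
    (h : Tendsto (fun s => g s / s) (𝓝[>] 0) (𝓝 c)) :
    g ~[𝓝[>] 0] fun s => c * s := by
  refine (isEquivalent_iff_tendsto_one ?_).2 ?_
  · filter_upwards [self_mem_nhdsWithin] with s (hs : 0 < s)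
    exact mul_ne_zero hc hs.ne'
  · have hlim := h.div_const c
    rw [div_self hc] at hlim
    exact hlim.congr fun s => by rw [Pi.div_apply, div_div, mul_comm s]

lemma exists_forall_le_mul_of_tendsto_div {g : ℝ → ℝ} {c M : ℝ} (hM : ∀ s, 0 < s → g s ≤ M)
    (h : Tendsto (fun s => g s / s) (𝓝[>] 0) (𝓝 c)) :
    ∃ K, ∀ s, 0 < s → g s ≤ K * s := by
  obtain ⟨s₀, hs₀ : 0 < s₀, hsub⟩ :=
    mem_nhdsGT_iff_exists_Ioo_subset.1 (h.eventually_lt_const (lt_add_one c))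
  refine ⟨max (c + 1) (|M| / s₀), fun s hs => ?_⟩
  rw [← div_le_iff₀ hs]
  rcases lt_or_ge s s₀ with hlt | hge
  · exact le_max_of_le_left (hsub ⟨hs, hlt⟩).le
  · refine le_max_of_le_right ?_
    have hg := (hM s hs).trans (le_abs_self M)
    gcongr

end Asymptotics

end GLMEP

theorem mainTheorem8_general {f : ℝ → ℝ} (D : GLMEP.Pieces f) (hp : 0 < D.p) {δ : ℝ} (hδ : 1 < δ) :
    ∃ C : ℝ, 0 < C ∧
      ∀ P : Measure ℝ, GLMEP.IsSpectralLaw P δ → GLMEP.perfectThreshold f P < (δ : EReal) →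
        (∀ s : ℝ, 0 < s →
          Tendsto (fun t : ℕ => GLMEP.mse P (GLMEP.VlNoisy f P δ s t)) atTop
            (𝓝 (GLMEP.mseStarNoisy f P δ s))) ∧
        (fun s : ℝ => GLMEP.mseStarNoisy f P δ s)
          ~[𝓝[>] (0 : ℝ)] (fun s : ℝ => C * (∫ x, x⁻¹ ∂P) * s) ∧
        ∃ K : ℝ, ∀ s : ℝ, 0 < s → GLMEP.mseStarNoisy f P δ s ≤ K * s := by
  have hf := D.measurable
  by_cases hpδ : 1 < D.p * δ
  · have hC : 0 < (δ - 1) / (D.p * δ - 1) := div_pos (sub_pos.2 hδ) (sub_pos.2 hpδ)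
    refine ⟨_, hC, fun P hP hthreshold => ?_⟩
    obtain ⟨δ', -, hδ', hpos⟩ := hP.exists_Pfun_pos_of_perfectThreshold_lt hf hthreshold
    have hlim := hP.tendsto_mseStarNoisy_div D hpδ (hP.tendsto_limitVr D hδ'.le hpos)
    refine ⟨fun s hs => ?_,
      GLMEP.isEquivalent_mul_of_tendsto_div (mul_pos hC hP.integral_inv_pos).ne' hlim,
      GLMEP.exists_forall_le_mul_of_tendsto_div (fun s hs => (hP.mseStarNoisy_mem hf hs).2) hlim⟩
    rw [hP.mseStarNoisy_eq hf hs]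
    exact hP.tendsto_mse hf hs
  · refine ⟨1, one_pos, fun P hP hthreshold => ?_⟩
    obtain ⟨δ', -, hδ', hpos⟩ := hP.exists_Pfun_pos_of_perfectThreshold_lt hf hthreshold
    exact absurd (hP.one_lt_p_mul D hp hδ' hpos) hpδ

theorem mainTheorem8 (f : ℝ → ℝ) (hf : GLMEP.PiecewiseSmooth f)
    (d : ℝ≥0) (hd : GLMEP.HasInformationDimension (GLMEP.outputLaw f) d) (hd0 : d ≠ 0)
    (δ : ℝ) (hδ : 1 < δ) :
    ∃ C : ℝ, 0 < C ∧
      ∀ P : Measure ℝ, GLMEP.IsSpectralLaw P δ → GLMEP.perfectThreshold f P < (δ : EReal) →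
        (∀ s : ℝ, 0 < s →
          Tendsto (fun t : ℕ => GLMEP.mse P (GLMEP.VlNoisy f P δ s t)) atTop
            (𝓝 (GLMEP.mseStarNoisy f P δ s))) ∧
        (fun s : ℝ => GLMEP.mseStarNoisy f P δ s)
          ~[𝓝[>] (0 : ℝ)] (fun s : ℝ => C * (∫ x, x⁻¹ ∂P) * s) ∧
        ∃ K : ℝ, ∀ s : ℝ, 0 < s → GLMEP.mseStarNoisy f P δ s ≤ K * s := by
  obtain ⟨D⟩ := hf.nonempty_pieces
  exact mainTheorem8_general D (D.p_pos hd hd0) hδ
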